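/- Let $(M,g)$ be a smooth Riemannian manifold (Hausdorff, second countable, without boundary; no completeness, connectedness or curvature assumption), let $\phi:M\to\mathbb R$ be smooth, and let $\mathcal L_\phi v=\Delta v-\langle\nabla v,\nabla\phi\rangle$, acting componentwise on maps $v:M\to\mathbb R^N$. All integrals over $M$ are with respect to the Riemannian volume. Put $\|v\|_{W^{1,2}_\phi}^2=\int_M(|v|^2+|\nabla v|^2)\,e^{-\phi}$ and let $W^{1,2}_\phi$ be the closure, in this norm, of the smooth compactly supported maps $M\to\mathbb R^N$ (if $g$ is complete, every smooth map of finite norm belongs to it). Let $a<b$ and let $u:M\times[a,b]\to\mathbb R^N$ be smooth such that $u(\cdot,t),u_t(\cdot,t)\in W^{1,2}_\phi$ for each $t\in[a,b]$, with $W^{1,2}_\phi$ norms bounded uniformly in $t\in[a,b]$, and suppose that $$(\partial_t-\mathcal L_\phi)\,u=0\quad\text{on } M\times[a,b].$$ Set $$I(t)=\int_M|u(\cdot,t)|^2e^{-\phi},\qquad D(t)=-\int_M|\nabla u(\cdot,t)|^2e^{-\phi},\qquad U(t)=\frac{D(t)}{I(t)}.$$ Then $$I(b)\ \ge\ I(a)\,e^{2U(a)(b-a)},$$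 where the right-hand side is read as $0$ if $I(a)=0$. In particular, backward uniqueness holds: if $u(\cdot,b)=0$, then $u\equiv0$ on $M\times[a,b]$. -/

import Mathlib

open scoped Manifold ContDiff ENNReal NNReal Topology
open MeasureTheory Filter

noncomputable section

namespace DriftHeat

variable {n : ℕ} {M : Type*} [TopologicalSpace M] [ChartedSpace (EuclideanSpace ℝ (Fin n)) M]
  [IsManifold (𝓡 n) ∞ M]

/-- A smooth Riemannian metric on the (boundaryless) smooth `n`-manifold `M`. -/
abbrev SmoothMetric (n : ℕ) (M : Type*) [TopologicalSpace M]
    [ChartedSpace (EuclideanSpace ℝ (Fin n)) M] [IsManifold (𝓡 n) ∞ M] : Type _ :=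
  Bundle.ContMDiffRiemannianMetric (𝓡 n) ∞ (EuclideanSpace ℝ (Fin n))
    (fun x : M => TangentSpace (𝓡 n) x)

/-! ### The Riemannian volume -/

/-- The `i`-th coordinate vector field of the chart around `p`, at the point of `M` whose
coordinate in this chart is `y`. -/
def coordVector (n : ℕ) {M : Type*} [TopologicalSpace M]
    [ChartedSpace (EuclideanSpace ℝ (Fin n)) M] (p : M) (y : EuclideanSpace ℝ (Fin n))
    (i : Fin n) : TangentSpace (𝓡 n) ((extChartAt (𝓡 n) p).symm y) :=
  mfderiv (𝓡 n) (𝓡 n) (extChartAt (𝓡 n) p).symm y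
    (EuclideanSpace.single i (1 : ℝ) : EuclideanSpace ℝ (Fin n))

/-- The matrix `g_{ij}` of the metric in the chart around `p`, at the coordinate `y`. -/
def gramMatrix (g : SmoothMetric n M) (p : M) (y : EuclideanSpace ℝ (Fin n)) :
    Matrix (Fin n) (Fin n) ℝ :=
  Matrix.of fun i j => g.inner _ (coordVector n p y i) (coordVector n p y j)

/-- The volume density `√(det g_{ij})` in the chart around `p`, at the coordinate `y`. -/
def volumeDensity (g : SmoothMetric n M) (p : M) (y : EuclideanSpace ℝ (Fin n)) : ℝ :=
  √((gramMatrix g p y).det)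

/-- The Riemannian volume of the domain of the chart around `p`: the image under the inverse chart
of the measure `√(det g_{ij}) dy` on the chart's target. -/
def chartVolume [MeasurableSpace M] (g : SmoothMetric n M) (p : M) : Measure M :=
  ((volume.restrict (extChartAt (𝓡 n) p).target).withDensity
    fun y => ENNReal.ofReal (volumeDensity g p y)).map (extChartAt (𝓡 n) p).symm

/-- The Riemannian volume measure: the least measure that dominates the volume `√(det g_{ij}) dy`
of every chart domain. By the change of variables formula the chart volumes agree on overlaps, and
countably many chart domains cover `M`, so this is the unique Borel measure
that restricts to `√(det g_{ij}) dy` on each chart domain. -/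
def riemannianVolume [MeasurableSpace M] (g : SmoothMetric n M) : Measure M :=
  ⨆ p : M, chartVolume g p

/-! ### Gradient, divergence and the drift Laplacian -/

/-- The metric on the tangent space at `x` as a bilinear form. -/
def metricForm (g : SmoothMetric n M) (x : M) : LinearMap.BilinForm ℝ (TangentSpace (𝓡 n) x) :=
  LinearMap.mk₂ ℝ (fun v w => g.inner x v w) (by intros; simp) (by intros; simp)
    (by intros; simp) (by intros; simp)

theorem metricForm_nondegenerate (g : SmoothMetric n M) (x : M) :
    (metricForm g x).Nondegenerate := by
  have key : ∀ v : TangentSpace (𝓡 n) x, g.inner x v v = 0 → v = 0 := by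
    intro v hv
    by_contra h
    exact absurd hv (g.pos x v h).ne'
  exact ⟨fun v hv => key v (hv v), fun v hv => key v (hv v)⟩

instance (x : M) : FiniteDimensional ℝ (TangentSpace (𝓡 n) x) :=
  inferInstanceAs (FiniteDimensional ℝ (EuclideanSpace ℝ (Fin n)))

/-- The differential of a real function, as a linear form on the tangent space at `x`. -/
def differential (f : M → ℝ) (x : M) : TangentSpace (𝓡 n) x →ₗ[ℝ] ℝ :=
  (show TangentSpace (𝓡 n) x →L[ℝ] ℝ from mfderiv (𝓡 n) 𝓘(ℝ, ℝ) f x).toLinearMap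

/-- The gradient of a real function: the tangent vector with `g (∇f) w = df(w)` for all `w`. -/
def riemannianGradient (g : SmoothMetric n M) (f : M → ℝ) (x : M) : TangentSpace (𝓡 n) x :=
  ((metricForm g x).toDual (metricForm_nondegenerate g x)).symm (differential f x)

theorem inner_riemannianGradient (g : SmoothMetric n M) (f : M → ℝ) (x : M)
    (w : TangentSpace (𝓡 n) x) :
    g.inner x (riemannianGradient g f x) w = differential f x w :=
  LinearMap.BilinForm.apply_toDual_symm_apply (B := metricForm g x)
    (hB := metricForm_nondegenerate g x)
    (differential f x) w

/-- The coordinates `X^i` of a vector field in the chart around `p`, as functions of the coordinate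
`y`. -/
def coordComponent (p : M) (X : ∀ x : M, TangentSpace (𝓡 n) x) (i : Fin n)
    (y : EuclideanSpace ℝ (Fin n)) : ℝ :=
  (show EuclideanSpace ℝ (Fin n) from
    mfderiv (𝓡 n) (𝓡 n) (extChartAt (𝓡 n) p) ((extChartAt (𝓡 n) p).symm y)
      (X ((extChartAt (𝓡 n) p).symm y))) i

/-- The divergence `(1 / √(det g)) ∑ i, ∂_i (√(det g) X^i)` of a vector field, computed at `p` in
the chart around `p`. -/
def divergence (g : SmoothMetric n M) (X : ∀ x : M, TangentSpace (𝓡 n) x) (p : M) : ℝ :=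
  (volumeDensity g p (extChartAt (𝓡 n) p p))⁻¹ *
    ∑ i, fderiv ℝ (fun y => volumeDensity g p y * coordComponent p X i y)
      (extChartAt (𝓡 n) p p) (EuclideanSpace.single i 1)

/-- The Laplace-Beltrami operator `Δ f = div ∇f`. -/
def laplacian (g : SmoothMetric n M) (f : M → ℝ) (x : M) : ℝ :=
  divergence g (riemannianGradient g f) x

/-- The drift Laplacian `L_φ v = Δ v - ⟨∇ v, ∇ φ⟩` of a vector-valued map, taken componentwise. -/
def driftLaplacian (g : SmoothMetric n M) (φ : M → ℝ) {N : ℕ} (v : M → EuclideanSpace ℝ (Fin N))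
    (x : M) : EuclideanSpace ℝ (Fin N) :=
  WithLp.toLp 2 fun k => laplacian g (fun y => v y k) x -
    g.inner x (riemannianGradient g (fun y => v y k) x) (riemannianGradient g φ x)

/-- `|∇v|²` for a vector-valued map `v`: the sum over the components of `v`. -/
def gradNormSq (g : SmoothMetric n M) {N : ℕ} (v : M → EuclideanSpace ℝ (Fin N)) (x : M) : ℝ :=
  ∑ k, g.inner x (riemannianGradient g (fun y => v y k) x) (riemannianGradient g (fun y => v y k) x)

/-! ### The weighted Sobolev space -/

section Measure

variable [MeasurableSpace M]

/-- The square of the `W^{1,2}_φ` norm of a smooth map: `∫ (|v|² + |∇v|²) e^{-φ}`, possibly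
infinite. -/
def sobolevNormSq (g : SmoothMetric n M) (φ : M → ℝ) {N : ℕ} (v : M → EuclideanSpace ℝ (Fin N)) :
    ℝ≥0∞ :=
  ∫⁻ x, ENNReal.ofReal ((‖v x‖ ^ 2 + gradNormSq g v x) * Real.exp (-φ x)) ∂riemannianVolume g

/-- The smooth maps in `W^{1,2}_φ`, the closure of the smooth maps with compact support
in the `W^{1,2}_φ` norm. -/
def SmoothMemW12 (g : SmoothMetric n M) (φ : M → ℝ) {N : ℕ} (v : M → EuclideanSpace ℝ (Fin N)) :
    Prop :=
  ContMDiff (𝓡 n) (𝓡 N) ∞ v ∧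
    ∃ ψ : ℕ → M → EuclideanSpace ℝ (Fin N),
      (∀ k, ContMDiff (𝓡 n) (𝓡 N) ∞ (ψ k) ∧ HasCompactSupport (ψ k)) ∧
      Tendsto (fun k => sobolevNormSq g φ (fun x => v x - ψ k x)) atTop (𝓝 0)

/-! ### The frequency -/

/-- `I = ∫ |v|² e^{-φ}`. -/
def energyI (g : SmoothMetric n M) (φ : M → ℝ) {N : ℕ} (v : M → EuclideanSpace ℝ (Fin N)) : ℝ :=
  ∫ x, ‖v x‖ ^ 2 * Real.exp (-φ x) ∂riemannianVolume g

/-- `D = -∫ |∇v|² e^{-φ}`. -/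
def energyD (g : SmoothMetric n M) (φ : M → ℝ) {N : ℕ} (v : M → EuclideanSpace ℝ (Fin N)) : ℝ :=
  -∫ x, gradNormSq g v x * Real.exp (-φ x) ∂riemannianVolume g

/-- The frequency `U = D / I`. -/
def frequency (g : SmoothMetric n M) (φ : M → ℝ) {N : ℕ} (v : M → EuclideanSpace ℝ (Fin N)) : ℝ :=
  energyD g φ v / energyI g φ v

end Measure

/-- The time derivative `u_t` of a map on `M × [a, b]` (one-sided at the end points). -/
def timeDeriv {M : Type*} {N : ℕ} (a b : ℝ) (u : M → ℝ → EuclideanSpace ℝ (Fin N)) (t : ℝ)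
    (x : M) : EuclideanSpace ℝ (Fin N) :=
  derivWithin (u x) (Set.Icc a b) t

end DriftHeat

end

/-! Regard `u` as a curve `U` in the Hilbert space `L²(e^{-φ} dvol)` and `u_t` as a curve `V`.
Testing the equation at time `s` against `u(·,t)` gives `⟪V s, U t⟫ = -∫ ⟨∇u(s), ∇u(t)⟩ e^{-φ}`,
which is symmetric in `s` and `t`. Since `V` is the weak derivative of `U`, moving `(s, t)` along a
line `s + t = const` does not change `⟪U s, U t⟫`: its derivative is `⟪V s, U t⟫ - ⟪U s, V t⟫ = 0`.
Hence `‖U((s+t)/2)‖² = ⟪U s, U t⟫ ≤ ‖U s‖ ‖U t‖`, so `log I` is midpoint convex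
(`norm_midpoint_sq_le`). Its tangent at `a` has slope `I'(a)/I(a) = 2D(a)/I(a)`, and convexity puts
`log I(b)` above this tangent (`norm_sq_exp_le`). If `U b = 0`, midpoint convexity carries the zero
to points that accumulate at any earlier time (`eq_zero_of_weakDeriv_of_end_eq_zero`).

`D` is never differentiated and no second derivative in time occurs. In the Hilbert space only three
facts are used: a bound on `‖V‖`, the symmetry, and the weak derivative identity.

The geometry supplies these facts. The symmetry is the weak form of `ℒ_φ`
(`integral_inner_eq_neg_gradPair`): Green's formula for compactly supported tests, extended to
`W^{1,2}_φ` by density. Green's formula is integration by parts in one chart, globalized by a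
partition of unity. It needs the Riemannian volume to equal the chart volume on each chart domain
(`riemannianVolume_apply_of_subset`) and the Laplacian to be independent of the chart
(`laplacian_eq_chartLaplacian`). The weak derivative identity is the fundamental theorem of calculus
at each point of `M`, combined with Fubini (`integral_inner_sub_eq`). -/

noncomputable section

namespace DriftHeat

/-! ### Log-convexity for curves in a Hilbert space with symmetric weak derivative -/

section Hilbert

variable {H : Type*} [NormedAddCommGroup H] [InnerProductSpace ℝ H]

local notation "⟪" x ", " y "⟫" => inner ℝ x y

/-- A function on `[0, 1]` whose increments are quadratically small is constant. -/
theorem eq_of_abs_sub_le_sq {f : ℝ → ℝ} {C : ℝ}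
    (hf : ∀ x ∈ Set.Icc (0 : ℝ) 1, ∀ y ∈ Set.Icc (0 : ℝ) 1, |f x - f y| ≤ C * (x - y) ^ 2) :
    f 1 = f 0 := by
  have hd : ∀ x ∈ Set.Icc (0 : ℝ) 1, HasDerivWithinAt f 0 (Set.Icc 0 1) x := by
    intro x hx
    rw [hasDerivWithinAt_iff_isLittleO]
    have h1 : (fun y => f y - f x - (y - x) • (0 : ℝ)) =O[𝓝[Set.Icc 0 1] x]
        fun y => (y - x) ^ 2 := by
      refine Asymptotics.IsBigO.of_bound C ?_
      filter_upwards [self_mem_nhdsWithin] with y hy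
      simpa using hf y hy x hx
    refine h1.trans_isLittleO ?_
    have : (fun y : ℝ => (y - x) ^ 2) =o[𝓝 x] fun y => y - x := by
      have h2 : Tendsto (fun y : ℝ => y - x) (𝓝 x) (𝓝 0) := by
        have : Continuous fun y : ℝ => y - x := by fun_prop
        simpa using this.tendsto x
      exact ((Asymptotics.isLittleO_pow_id (𝕜 := ℝ) one_lt_two).comp_tendsto h2)
    exact this.mono nhdsWithin_le_nhds
  refine constant_of_has_deriv_right_zero (a := 0) (b := 1)
    (fun x hx => (hd x hx).continuousWithinAt) (fun x hx => ?_) 1 (by simp)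
  exact (hd x ⟨hx.1, hx.2.le⟩).mono_of_mem_nhdsWithin (Icc_mem_nhdsGE_of_mem hx)

variable {a b K : ℝ} {U V : ℝ → H}

/-- Testing the weak identity with `w = U t - U s` itself gives a Lipschitz bound without any
Bochner integral of `V`. -/
theorem norm_sub_le_of_weakDeriv
    (hK : ∀ t ∈ Set.Icc a b, ‖V t‖ ≤ K)
    (hint : ∀ w : H, ∀ s ∈ Set.Icc a b, ∀ t ∈ Set.Icc a b,
      ⟪w, U t - U s⟫ = ∫ τ in s..t, ⟪w, V τ⟫)
    {s t : ℝ} (hs : s ∈ Set.Icc a b) (ht : t ∈ Set.Icc a b) :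
    ‖U t - U s‖ ≤ K * |t - s| := by
  set w := U t - U s with hw
  have h1 : ‖∫ τ in s..t, ⟪w, V τ⟫‖ ≤ (‖w‖ * K) * |t - s| := by
    refine intervalIntegral.norm_integral_le_of_norm_le_const fun τ hτ => ?_
    have : τ ∈ Set.Icc a b := Set.uIcc_subset_Icc hs ht (Set.uIoc_subset_uIcc hτ)
    exact (norm_inner_le_norm _ _).trans (by gcongr; exact hK τ this)
  rw [← hint w s hs t ht, ← hw, real_inner_self_eq_norm_sq, Real.norm_of_nonneg (sq_nonneg _)] at h1
  by_cases h0 : ‖w‖ = 0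
  · rw [h0]
    have : 0 ≤ K := (norm_nonneg _).trans (hK t ht)
    positivity
  · have : 0 < ‖w‖ := lt_of_le_of_ne (norm_nonneg _) (Ne.symm h0)
    nlinarith

/-- `V` is not assumed continuous, but the symmetry moves the varying time from `V` to `U`, which is
Lipschitz. -/
theorem abs_inner_sub_le
    (hK : ∀ t ∈ Set.Icc a b, ‖V t‖ ≤ K)
    (hsym : ∀ s ∈ Set.Icc a b, ∀ t ∈ Set.Icc a b, ⟪U s, V t⟫ = ⟪V s, U t⟫)
    (hint : ∀ w : H, ∀ s ∈ Set.Icc a b, ∀ t ∈ Set.Icc a b,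
      ⟪w, U t - U s⟫ = ∫ τ in s..t, ⟪w, V τ⟫)
    {s t t' : ℝ} (hs : s ∈ Set.Icc a b) (ht : t ∈ Set.Icc a b) (ht' : t' ∈ Set.Icc a b) :
    |⟪U s, V t'⟫ - ⟪U s, V t⟫| ≤ K ^ 2 * |t' - t| := by
  rw [hsym s hs t ht, hsym s hs t' ht', ← inner_sub_right]
  have hK0 : 0 ≤ K := (norm_nonneg _).trans (hK t ht)
  calc |⟪V s, U t' - U t⟫| ≤ ‖V s‖ * ‖U t' - U t‖ := abs_real_inner_le_norm _ _
    _ ≤ K * (K * |t' - t|) := by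
        gcongr
        · exact hK s hs
        · exact norm_sub_le_of_weakDeriv hK hint ht ht'
    _ = _ := by ring

/-- First-order Taylor expansion: the integrand `⟪U s, V τ⟫` of the weak identity is Lipschitz in
`τ`, so freezing it at `t` costs a quadratic error. -/
theorem abs_inner_sub_sub_le
    (hK : ∀ t ∈ Set.Icc a b, ‖V t‖ ≤ K)
    (hsym : ∀ s ∈ Set.Icc a b, ∀ t ∈ Set.Icc a b, ⟪U s, V t⟫ = ⟪V s, U t⟫)
    (hint : ∀ w : H, ∀ s ∈ Set.Icc a b, ∀ t ∈ Set.Icc a b,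
      ⟪w, U t - U s⟫ = ∫ τ in s..t, ⟪w, V τ⟫)
    {s t t' : ℝ} (hs : s ∈ Set.Icc a b) (ht : t ∈ Set.Icc a b) (ht' : t' ∈ Set.Icc a b) :
    |⟪U s, U t' - U t⟫ - (t' - t) * ⟪U s, V t⟫| ≤ K ^ 2 * (t' - t) ^ 2 := by
  have hsub : Set.uIcc t t' ⊆ Set.Icc a b := Set.uIcc_subset_Icc ht ht'
  have hcont : ContinuousOn (fun τ => ⟪U s, V τ⟫) (Set.uIcc t t') := by
    have : LipschitzOnWith (K ^ 2).toNNReal (fun τ => ⟪U s, V τ⟫) (Set.uIcc t t') := by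
      refine LipschitzOnWith.of_dist_le_mul fun x hx y hy => ?_
      rw [Real.dist_eq, Real.dist_eq, Real.coe_toNNReal _ (sq_nonneg K)]
      exact abs_inner_sub_le hK hsym hint hs (hsub hy) (hsub hx)
    exact this.continuousOn
  have h1 : ⟪U s, U t' - U t⟫ - (t' - t) * ⟪U s, V t⟫ =
      ∫ τ in t..t', (⟪U s, V τ⟫ - ⟪U s, V t⟫) := by
    rw [intervalIntegral.integral_sub hcont.intervalIntegrable (by simp), hint _ t ht t' ht',
      intervalIntegral.integral_const, smul_eq_mul]
  rw [h1, ← Real.norm_eq_abs]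
  calc ‖∫ τ in t..t', (⟪U s, V τ⟫ - ⟪U s, V t⟫)‖ ≤ (K ^ 2 * |t' - t|) * |t' - t| := by
        refine intervalIntegral.norm_integral_le_of_norm_le_const fun τ hτ => ?_
        have hτ' := Set.uIoc_subset_uIcc hτ
        refine (abs_inner_sub_le hK hsym hint hs ht (hsub hτ')).trans ?_
        have := Set.abs_sub_left_of_mem_uIcc hτ'
        gcongr
    _ = _ := by rw [mul_assoc, ← sq, sq_abs]

/-- Change first the right, then the left argument. As `t' - t = -(s' - s)`, the two linear terms
cancel by symmetry, up to replacing `V s'` by `V s`. The two Taylor remainders and this replacement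
contribute `K² (s' - s)²` each. -/
theorem abs_inner_diag_sub_le
    (hK : ∀ t ∈ Set.Icc a b, ‖V t‖ ≤ K)
    (hsym : ∀ s ∈ Set.Icc a b, ∀ t ∈ Set.Icc a b, ⟪U s, V t⟫ = ⟪V s, U t⟫)
    (hint : ∀ w : H, ∀ s ∈ Set.Icc a b, ∀ t ∈ Set.Icc a b,
      ⟪w, U t - U s⟫ = ∫ τ in s..t, ⟪w, V τ⟫)
    {s s' t t' : ℝ} (hs : s ∈ Set.Icc a b) (hs' : s' ∈ Set.Icc a b) (ht : t ∈ Set.Icc a b)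
    (ht' : t' ∈ Set.Icc a b) (h : s' + t' = s + t) :
    |⟪U s', U t'⟫ - ⟪U s, U t⟫| ≤ 3 * K ^ 2 * (s' - s) ^ 2 := by
  have h1 := abs_inner_sub_sub_le hK hsym hint hs' ht ht'
  have h2 := abs_inner_sub_sub_le hK hsym hint ht hs hs'
  have h3 := abs_inner_sub_le hK hsym hint ht hs hs'
  have e1 : ⟪U s', V t⟫ = ⟪U t, V s'⟫ := by rw [hsym s' hs' t ht, real_inner_comm]
  have e2 : t' - t = -(s' - s) := by linarith
  have h4 : |(s' - s) * (⟪U t, V s'⟫ - ⟪U t, V s⟫)| ≤ K ^ 2 * (s' - s) ^ 2 := by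
    rw [abs_mul]
    calc _ ≤ |s' - s| * (K ^ 2 * |s' - s|) := by gcongr
      _ = K ^ 2 * |s' - s| ^ 2 := by ring
      _ = _ := by rw [sq_abs]
  rw [e1, e2, inner_sub_right] at h1
  rw [inner_sub_right] at h2
  rw [real_inner_comm (U t) (U s'), real_inner_comm (U t) (U s)] at *
  rw [abs_le] at *
  constructor <;> nlinarith

/-- `⟪U s, U t⟫` depends on `s + t` only, hence `‖U‖` is midpoint log-convex. -/
theorem norm_midpoint_sq_le
    (hK : ∀ t ∈ Set.Icc a b, ‖V t‖ ≤ K)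
    (hsym : ∀ s ∈ Set.Icc a b, ∀ t ∈ Set.Icc a b, ⟪U s, V t⟫ = ⟪V s, U t⟫)
    (hint : ∀ w : H, ∀ s ∈ Set.Icc a b, ∀ t ∈ Set.Icc a b,
      ⟪w, U t - U s⟫ = ∫ τ in s..t, ⟪w, V τ⟫)
    {s t : ℝ} (hs : s ∈ Set.Icc a b) (ht : t ∈ Set.Icc a b) :
    ‖U ((s + t) / 2)‖ ^ 2 ≤ ‖U s‖ * ‖U t‖ := by
  have hm : (s + t) / 2 ∈ Set.Icc a b := ⟨by linarith [hs.1, ht.1], by linarith [hs.2, ht.2]⟩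
  set m := (s + t) / 2
  have hmem : ∀ r ∈ Set.Icc a b, ∀ θ ∈ Set.Icc (0 : ℝ) 1, m + θ * (r - m) ∈ Set.Icc a b := by
    intro r hr θ hθ
    have := (convex_Icc a b) hm hr (sub_nonneg.2 hθ.2) hθ.1 (by ring)
    convert this using 1
    simp only [smul_eq_mul]
    ring
  -- The segment from `(m, m)` to `(s, t)` stays on the line of constant sum `2m`; its ends give `‖U
  -- m‖²` and `⟪U s, U t⟫`.
  have key := eq_of_abs_sub_le_sq (f := fun θ => ⟪U (m + θ * (s - m)), U (m + θ * (t - m))⟫)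
    (C := 3 * K ^ 2 * (s - m) ^ 2) (fun x hx y hy => by
      refine (abs_inner_diag_sub_le hK hsym hint (hmem s hs y hy) (hmem s hs x hx)
        (hmem t ht y hy) (hmem t ht x hx) ?_).trans (le_of_eq ?_)
      · have : s - m + (t - m) = 0 := by simp only [m]; ring
        linear_combination (x - y) * this
      · ring)
  simp only [one_mul, zero_mul, add_zero, add_sub_cancel, real_inner_self_eq_norm_sq] at key
  rw [← key]
  exact real_inner_le_norm _ _

/-- Repeated halving of the distance to `a` bounds the ratio `r 0` at `b` below by `r k ^ 2 ^ k`.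
The Taylor expansion at `a` gives `r k ≥ 1 + c / 2 ^ k - d / 4 ^ k`, and the powers of the
right-hand side tend to `exp c`. This replaces the tangent line argument for convex functions, and
it requires no positivity of `‖U t‖` for `t > a`. -/
theorem norm_sq_exp_le
    (hab : a < b) (hK : ∀ t ∈ Set.Icc a b, ‖V t‖ ≤ K)
    (hsym : ∀ s ∈ Set.Icc a b, ∀ t ∈ Set.Icc a b, ⟪U s, V t⟫ = ⟪V s, U t⟫)
    (hint : ∀ w : H, ∀ s ∈ Set.Icc a b, ∀ t ∈ Set.Icc a b,
      ⟪w, U t - U s⟫ = ∫ τ in s..t, ⟪w, V τ⟫) :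
    ‖U a‖ ^ 2 * Real.exp (2 * (⟪U a, V a⟫ / ‖U a‖ ^ 2) * (b - a)) ≤ ‖U b‖ ^ 2 := by
  have ha : a ∈ Set.Icc a b := ⟨le_rfl, hab.le⟩
  by_cases h0 : ‖U a‖ = 0
  · rw [h0, zero_pow two_ne_zero, zero_mul]
    positivity
  have hpos : 0 < ‖U a‖ ^ 2 := by positivity
  have hmem : ∀ k : ℕ, a + (b - a) / 2 ^ k ∈ Set.Icc a b := by
    intro k
    have h1 : 0 ≤ (b - a) / 2 ^ k := by
      have := sub_pos.2 hab
      positivity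
    have h2 : (b - a) / 2 ^ k ≤ b - a := div_le_self (sub_pos.2 hab).le (one_le_pow₀ one_le_two)
    exact ⟨by linarith, by linarith⟩
  set r : ℕ → ℝ := fun k => ‖U (a + (b - a) / 2 ^ k)‖ ^ 2 / ‖U a‖ ^ 2 with hr
  have hr0 : ∀ k, 0 ≤ r k := fun k => by positivity
  have hstep : ∀ k, r (k + 1) ^ 2 ≤ r k := by
    intro k
    have h1 := norm_midpoint_sq_le hK hsym hint ha (hmem k)
    have h2 : (a + (a + (b - a) / 2 ^ k)) / 2 = a + (b - a) / 2 ^ (k + 1) := by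
      rw [pow_succ]; field_simp; ring
    rw [h2] at h1
    simp only [hr]
    rw [div_pow, div_le_div_iff₀ (by positivity) hpos]
    have h3 : (‖U (a + (b - a) / 2 ^ (k + 1))‖ ^ 2) ^ 2 ≤ (‖U a‖ * ‖U (a + (b - a) / 2 ^ k)‖) ^ 2 := by
      gcongr
    calc _ ≤ (‖U a‖ * ‖U (a + (b - a) / 2 ^ k)‖) ^ 2 * ‖U a‖ ^ 2 := by gcongr
      _ = _ := by ring
  have hiter : ∀ k, r k ^ 2 ^ k ≤ r 0 := by
    intro k
    induction k with
    | zero => simp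
    | succ k ih =>
      refine le_trans ?_ ih
      rw [pow_succ', pow_mul]
      exact pow_le_pow_left₀ (sq_nonneg _) (hstep k) _
  set c := 2 * (⟪U a, V a⟫ / ‖U a‖ ^ 2) * (b - a) with hc
  set d := 2 * K ^ 2 * (b - a) ^ 2 / ‖U a‖ ^ 2 with hd
  set g : ℕ → ℝ := fun n => c / n - d / n ^ 2 with hg
  have hlow : ∀ k, 1 + g (2 ^ k) ≤ r k := by
    intro k
    -- The Taylor expansion controls only `⟪U a, U t⟫`; `2⟪x, y⟫ ≤ ‖x‖² + ‖y‖²` turns it into a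
    -- lower bound for `‖U t‖²` and accounts for the factor 2 in `c` and `d`.
    have h1 := abs_inner_sub_sub_le hK hsym hint ha ha (hmem k)
    rw [add_sub_cancel_left, abs_le, inner_sub_right, real_inner_self_eq_norm_sq] at h1
    have h2 : 2 * ⟪U a, U (a + (b - a) / 2 ^ k)⟫ ≤
        ‖U a‖ ^ 2 + ‖U (a + (b - a) / 2 ^ k)‖ ^ 2 := by
      have := norm_sub_sq_real (U a) (U (a + (b - a) / 2 ^ k))
      nlinarith [sq_nonneg ‖U a - U (a + (b - a) / 2 ^ k)‖]
    have h3 : 1 + g (2 ^ k) = (‖U a‖ ^ 2 + (2 * ((b - a) / 2 ^ k * ⟪U a, V a⟫) -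
        2 * (K ^ 2 * ((b - a) / 2 ^ k) ^ 2))) / ‖U a‖ ^ 2 := by
      simp only [hg, hc, hd]
      push_cast
      field_simp
    rw [h3]
    simp only [hr]
    gcongr
    linarith [h1.1]
  have hlim : Tendsto (fun n : ℕ => (1 + g n) ^ n) atTop (𝓝 (Real.exp c)) := by
    refine Real.tendsto_one_add_pow_exp_of_tendsto ?_
    have h1 : Tendsto (fun n : ℕ => c - d / n) atTop (𝓝 (c - 0)) :=
      tendsto_const_nhds.sub (tendsto_const_div_atTop_nhds_zero_nat d)
    rw [sub_zero] at h1
    refine h1.congr' ?_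
    filter_upwards [eventually_gt_atTop 0] with n hn
    simp only [hg]
    field_simp
  have hg0 : Tendsto g atTop (𝓝 0) := by
    have h1 := tendsto_const_div_atTop_nhds_zero_nat c
    have h2 := (tendsto_const_div_atTop_nhds_zero_nat d).mul
      (tendsto_one_div_atTop_nhds_zero_nat (𝕜 := ℝ))
    have := h1.sub h2
    simp only [mul_zero, sub_zero] at this
    refine this.congr fun n => ?_
    simp only [hg]
    rw [div_mul_div_comm, mul_one, sq]
  have h2k : Tendsto (fun k : ℕ => 2 ^ k) atTop (atTop : Filter ℕ) :=
    tendsto_pow_atTop_atTop_of_one_lt one_lt_two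
  have hfin : Real.exp c ≤ r 0 := by
    refine le_of_tendsto (hlim.comp h2k) ?_
    -- Raising `hlow` to a power needs a nonnegative base `1 + g (2 ^ k)`.
    have : ∀ᶠ k in atTop, -1 < g (2 ^ k) :=
      (hg0.comp h2k).eventually (lt_mem_nhds (by norm_num))
    filter_upwards [this] with k hk
    refine le_trans ?_ (hiter k)
    exact pow_le_pow_left₀ (by linarith) (hlow k) _
  simp only [hr, pow_zero, div_one, add_sub_cancel] at hfin
  rw [le_div_iff₀ hpos] at hfin
  linarith

/-- A zero at `t + h` forces one at the midpoint `t + h/2`, since `‖U (t + h/2)‖² ≤ ‖U t‖ ‖U (t +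
h)‖`. The zeros accumulate at `t`, and `U` is Lipschitz. -/
theorem eq_zero_of_weakDeriv_of_end_eq_zero
    (hK : ∀ t ∈ Set.Icc a b, ‖V t‖ ≤ K)
    (hsym : ∀ s ∈ Set.Icc a b, ∀ t ∈ Set.Icc a b, ⟪U s, V t⟫ = ⟪V s, U t⟫)
    (hint : ∀ w : H, ∀ s ∈ Set.Icc a b, ∀ t ∈ Set.Icc a b,
      ⟪w, U t - U s⟫ = ∫ τ in s..t, ⟪w, V τ⟫)
    (hb : U b = 0) {t : ℝ} (ht : t ∈ Set.Icc a b) : U t = 0 := by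
  have hmem : ∀ k : ℕ, t + (b - t) / 2 ^ k ∈ Set.Icc a b := by
    intro k
    have h0 := sub_nonneg.2 ht.2
    have h1 : 0 ≤ (b - t) / 2 ^ k := by positivity
    have h2 : (b - t) / 2 ^ k ≤ b - t := div_le_self h0 (one_le_pow₀ one_le_two)
    exact ⟨by linarith [ht.1], by linarith⟩
  have hz : ∀ k : ℕ, U (t + (b - t) / 2 ^ k) = 0 := by
    intro k
    induction k with
    | zero => simpa using hb
    | succ k ih =>
      have h1 := norm_midpoint_sq_le hK hsym hint ht (hmem k)
      have h2 : (t + (t + (b - t) / 2 ^ k)) / 2 = t + (b - t) / 2 ^ (k + 1) := by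
        rw [pow_succ]; field_simp; ring
      rw [h2, ih, norm_zero, mul_zero] at h1
      have : ‖U (t + (b - t) / 2 ^ (k + 1))‖ = 0 :=
        pow_eq_zero_iff two_ne_zero |>.1 (le_antisymm h1 (sq_nonneg _))
      exact norm_eq_zero.1 this
  have hle : ∀ k : ℕ, ‖U t‖ ≤ K * (|b - t| / 2 ^ k) := by
    intro k
    have := norm_sub_le_of_weakDeriv hK hint (hmem k) ht
    rw [hz k, sub_zero] at this
    refine this.trans (le_of_eq ?_)
    rw [sub_add_cancel_left, abs_neg, abs_div, abs_of_pos (a := (2 : ℝ) ^ k) (by positivity)]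
  have hlim : Tendsto (fun k : ℕ => K * (|b - t| / 2 ^ k)) atTop (𝓝 (K * 0)) :=
    (tendsto_const_nhds.div_atTop (tendsto_pow_atTop_atTop_of_one_lt one_lt_two)).const_mul K
  rw [mul_zero] at hlim
  exact norm_le_zero_iff.1 (ge_of_tendsto' hlim hle)

end Hilbert

/-! ### Metric, volume density and gradients in charts, and their change under transition maps -/

section ChartGeometry

variable {n : ℕ} {M : Type*} [TopologicalSpace M] [ChartedSpace (EuclideanSpace ℝ (Fin n)) M]

local notation "𝔼" => EuclideanSpace ℝ (Fin n)

/-- The differential of the inverse chart around `p`, as a map of the model space. -/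
def chartFrame (n : ℕ) {M : Type*} [TopologicalSpace M]
    [ChartedSpace (EuclideanSpace ℝ (Fin n)) M] (p : M) (y : EuclideanSpace ℝ (Fin n)) :
    EuclideanSpace ℝ (Fin n) →L[ℝ] EuclideanSpace ℝ (Fin n) :=
  mfderiv (𝓡 n) (𝓡 n) (extChartAt (𝓡 n) p).symm y

/-- The differential of the chart around `p`, as a map of the model space. -/
def chartCoframe (n : ℕ) {M : Type*} [TopologicalSpace M]
    [ChartedSpace (EuclideanSpace ℝ (Fin n)) M] (p : M) (x : M) :
    EuclideanSpace ℝ (Fin n) →L[ℝ] EuclideanSpace ℝ (Fin n) :=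
  mfderiv (𝓡 n) (𝓡 n) (extChartAt (𝓡 n) p) x

variable [IsManifold (𝓡 n) ∞ M]

/-- The metric at `x` as a bilinear map on the model space. -/
def metricAt (g : SmoothMetric n M) (x : M) :
    EuclideanSpace ℝ (Fin n) →L[ℝ] EuclideanSpace ℝ (Fin n) →L[ℝ] ℝ := g.inner x

theorem gramMatrix_apply (g : SmoothMetric n M) (p : M) (y : 𝔼) (i j : Fin n) :
    gramMatrix g p y i j = metricAt g ((extChartAt (𝓡 n) p).symm y)
      (chartFrame n p y (EuclideanSpace.single i 1))
      (chartFrame n p y (EuclideanSpace.single j 1)) := rfl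

theorem metricAt_symm (g : SmoothMetric n M) (x : M) (v w : 𝔼) :
    metricAt g x v w = metricAt g x w v := g.symm x v w

theorem metricAt_pos (g : SmoothMetric n M) (x : M) {v : 𝔼} (hv : v ≠ 0) :
    0 < metricAt g x v v := g.pos x v hv

theorem mdifferentiableAt_extChartAt_symm (p : M) {y : 𝔼} (hy : y ∈ (extChartAt (𝓡 n) p).target) :
    MDifferentiableAt (𝓡 n) (𝓡 n) (extChartAt (𝓡 n) p).symm y := by
  have : IsManifold (𝓡 n) 1 M := IsManifold.of_le (n := ∞) (by norm_num)
  have h := mdifferentiableWithinAt_extChartAt_symm hy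
  rwa [ModelWithCorners.range_eq_univ, mdifferentiableWithinAt_univ] at h

theorem chartCoframe_chartFrame (p : M) {y : 𝔼} (hy : y ∈ (extChartAt (𝓡 n) p).target) (v : 𝔼) :
    chartCoframe n p ((extChartAt (𝓡 n) p).symm y) (chartFrame n p y v) = v := by
  have : IsManifold (𝓡 n) 1 M := IsManifold.of_le (n := ∞) (by norm_num)
  have h := mfderiv_extChartAt_comp_mfderivWithin_extChartAt_symm hy
  rw [ModelWithCorners.range_eq_univ, mfderivWithin_univ] at h
  exact DFunLike.congr_fun h v

theorem chartFrame_chartCoframe (p : M) {y : 𝔼} (hy : y ∈ (extChartAt (𝓡 n) p).target) (v : 𝔼) :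
    chartFrame n p y (chartCoframe n p ((extChartAt (𝓡 n) p).symm y) v) = v := by
  have : IsManifold (𝓡 n) 1 M := IsManifold.of_le (n := ∞) (by norm_num)
  have h := mfderivWithin_extChartAt_symm_comp_mfderiv_extChartAt hy
  rw [ModelWithCorners.range_eq_univ, mfderivWithin_univ] at h
  exact DFunLike.congr_fun h v

theorem sum_smul_single (v : 𝔼) : ∑ i, v i • (EuclideanSpace.single i (1 : ℝ) : 𝔼) = v := by
  simpa using (EuclideanSpace.basisFun (Fin n) ℝ).sum_repr v

/-- The Gram matrix is the metric pulled back by the chart frame, which is injective because the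
coframe is its left inverse. -/
theorem gramMatrix_posDef (g : SmoothMetric n M) (p : M) {y : 𝔼}
    (hy : y ∈ (extChartAt (𝓡 n) p).target) : (gramMatrix g p y).PosDef := by
  refine Matrix.PosDef.of_dotProduct_mulVec_pos ?_ fun v hv => ?_
  · ext i j
    simp only [Matrix.conjTranspose_apply, gramMatrix_apply, star_trivial]
    exact metricAt_symm _ _ _ _
  · have h1 : star v ⬝ᵥ (gramMatrix g p y).mulVec v =
        metricAt g ((extChartAt (𝓡 n) p).symm y) (chartFrame n p y (WithLp.toLp 2 v))
          (chartFrame n p y (WithLp.toLp 2 v)) := by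
      conv_rhs => rw [← sum_smul_single (WithLp.toLp 2 v)]
      simp only [map_sum, map_smul, sum_apply, smul_apply,
        smul_eq_mul, dotProduct, Matrix.mulVec, gramMatrix_apply, star_trivial, Finset.mul_sum]
      rw [Finset.sum_comm]
      refine Finset.sum_congr rfl fun i _ => Finset.sum_congr rfl fun j _ => ?_
      simp
      ring
    rw [h1]
    refine metricAt_pos _ _ fun h0 => hv ?_
    have := chartCoframe_chartFrame p hy (WithLp.toLp 2 v)
    rw [h0, map_zero] at this
    simpa using this.symm

theorem gramMatrix_det_pos (g : SmoothMetric n M) (p : M) {y : 𝔼}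
    (hy : y ∈ (extChartAt (𝓡 n) p).target) : 0 < (gramMatrix g p y).det :=
  (gramMatrix_posDef g p hy).det_pos

theorem volumeDensity_pos (g : SmoothMetric n M) (p : M) {y : 𝔼}
    (hy : y ∈ (extChartAt (𝓡 n) p).target) : 0 < volumeDensity g p y :=
  Real.sqrt_pos.2 (gramMatrix_det_pos g p hy)

/-- The coordinate field is the tangent map of the inverse chart applied to a constant section. -/
theorem contMDiffOn_coordVector (p : M) (i : Fin n) :
    ContMDiffOn (𝓡 n) (𝓡 n).tangent ∞
      (fun y => (⟨(extChartAt (𝓡 n) p).symm y, coordVector n p y i⟩ : TangentBundle (𝓡 n) M))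
      (extChartAt (𝓡 n) p).target := by
  have h1 : ContMDiffOn (𝓡 n) (𝓡 n) ∞ (extChartAt (𝓡 n) p).symm (extChartAt (𝓡 n) p).target :=
    contMDiffOn_extChartAt_symm p
  have hU := (isOpen_extChartAt_target (I := 𝓡 n) p).uniqueMDiffOn (I := 𝓡 n)
  have h2 := h1.contMDiffOn_tangentMapWithin (m := ∞) le_rfl hU
  have h3 : ContMDiffOn (𝓡 n) (𝓡 n).tangent ∞
      (fun y : 𝔼 => (⟨y, (EuclideanSpace.single i 1 : 𝔼)⟩ : TangentBundle (𝓡 n) 𝔼))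
      (extChartAt (𝓡 n) p).target :=
    contMDiffOn_vectorSpace_iff_contDiffOn.2 contDiffOn_const
  refine (h2.comp h3 fun y hy => hy).congr fun y hy => ?_
  simp only [Function.comp, tangentMapWithin]
  rw [mfderivWithin_of_isOpen (isOpen_extChartAt_target p) hy]
  rfl

theorem contDiffOn_gramMatrix (g : SmoothMetric n M) (p : M) (i j : Fin n) :
    ContDiffOn ℝ ∞ (fun y => gramMatrix g p y i j) (extChartAt (𝓡 n) p).target := by
  rw [← contMDiffOn_iff_contDiffOn]
  intro y hy
  have : ContMDiffWithinAt (𝓡 n) ((𝓡 n).prod 𝓘(ℝ)) ∞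
      (fun m => Bundle.TotalSpace.mk' ℝ (E := Bundle.Trivial M ℝ) ((extChartAt (𝓡 n) p).symm m)
        (g.inner ((extChartAt (𝓡 n) p).symm m) (coordVector n p m i) (coordVector n p m j)))
        (extChartAt (𝓡 n) p).target y := by
    apply ContMDiffWithinAt.clm_bundle_apply₂ (F₁ := 𝔼) (F₂ := 𝔼)
    · exact ContMDiffAt.comp_contMDiffWithinAt y g.contMDiff.contMDiffAt
        (contMDiffOn_extChartAt_symm p y hy)
    · exact contMDiffOn_coordVector p i y hy
    · exact contMDiffOn_coordVector p j y hy
  simp only [Bundle.contMDiffWithinAt_totalSpace] at this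
  exact this.2

theorem contDiffOn_det {m : ℕ} {X : Type*} [NormedAddCommGroup X] [NormedSpace ℝ X] {s : Set X}
    {A : X → Matrix (Fin m) (Fin m) ℝ} (hA : ∀ i j, ContDiffOn ℝ ∞ (fun y => A y i j) s) :
    ContDiffOn ℝ ∞ (fun y => (A y).det) s := by
  simp only [Matrix.det_apply]
  refine ContDiffOn.sum fun σ _ => ?_
  refine ContDiffOn.const_smul _ (contDiffOn_prod fun i _ => hA _ _)

/-- Cramer's rule: the entries of the inverse are quotients of determinants in the entries of the
matrix. -/
theorem contDiffOn_inv {m : ℕ} {X : Type*} [NormedAddCommGroup X] [NormedSpace ℝ X] {s : Set X}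
    {A : X → Matrix (Fin m) (Fin m) ℝ} (hA : ∀ i j, ContDiffOn ℝ ∞ (fun y => A y i j) s)
    (h0 : ∀ y ∈ s, (A y).det ≠ 0) (i j : Fin m) :
    ContDiffOn ℝ ∞ (fun y => (A y)⁻¹ i j) s := by
  simp only [Matrix.inv_def, Matrix.smul_apply, smul_eq_mul, Ring.inverse_eq_inv,
    Matrix.adjugate_apply]
  refine ((contDiffOn_det hA).inv h0).mul (contDiffOn_det fun k l => ?_)
  simp only [Matrix.updateRow_apply]
  split_ifs
  · exact contDiffOn_const
  · exact hA k l

theorem contDiffOn_volumeDensity (g : SmoothMetric n M) (p : M) :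
    ContDiffOn ℝ ∞ (volumeDensity g p) (extChartAt (𝓡 n) p).target :=
  (contDiffOn_det (contDiffOn_gramMatrix g p)).sqrt fun _ hy => (gramMatrix_det_pos g p hy).ne'

/-! ### Functions and gradients in a chart -/

/-- A function on `M` read in the chart around `p`. -/
def inChart (n : ℕ) {M : Type*} [TopologicalSpace M]
    [ChartedSpace (EuclideanSpace ℝ (Fin n)) M] {F : Type*} (p : M) (f : M → F)
    (y : EuclideanSpace ℝ (Fin n)) : F :=
  f ((extChartAt (𝓡 n) p).symm y)

theorem contDiffOn_inChart (p : M) {f : M → ℝ} (hf : ContMDiff (𝓡 n) 𝓘(ℝ, ℝ) ∞ f) :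
    ContDiffOn ℝ ∞ (inChart n p f) (extChartAt (𝓡 n) p).target := by
  rw [← contMDiffOn_iff_contDiffOn]
  exact hf.comp_contMDiffOn (contMDiffOn_extChartAt_symm p)

theorem differential_chartFrame (p : M) {f : M → ℝ} (hf : ContMDiff (𝓡 n) 𝓘(ℝ, ℝ) ∞ f) {y : 𝔼}
    (hy : y ∈ (extChartAt (𝓡 n) p).target) (v : 𝔼) :
    differential f ((extChartAt (𝓡 n) p).symm y) (chartFrame n p y v) =
      fderiv ℝ (inChart n p f) y v := by
  have h1 := mfderiv_comp (I := 𝓡 n) (I' := 𝓡 n) (I'' := 𝓘(ℝ, ℝ)) y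
    (g := f) (f := (extChartAt (𝓡 n) p).symm) (hf.mdifferentiableAt (by simp))
    (mdifferentiableAt_extChartAt_symm p hy)
  have h2 : mfderiv (𝓡 n) 𝓘(ℝ, ℝ) (f ∘ (extChartAt (𝓡 n) p).symm) y =
    fderiv ℝ (inChart n p f) y := mfderiv_eq_fderiv
  rw [h1] at h2
  exact DFunLike.congr_fun h2 v

theorem metricAt_riemannianGradient (g : SmoothMetric n M) (f : M → ℝ) (x : M) (w : 𝔼) :
    metricAt g x (riemannianGradient g f x) w = differential f x w :=
  inner_riemannianGradient g f x w

/-- The `i`-th coordinate of the gradient in the chart around `p`. -/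
def gradComponent (g : SmoothMetric n M) (p : M) (f : M → ℝ) (i : Fin n) (y : 𝔼) : ℝ :=
  coordComponent p (riemannianGradient g f) i y

theorem gradComponent_eq_chartCoframe (g : SmoothMetric n M) (p : M) (f : M → ℝ) (i : Fin n)
    (y : 𝔼) : gradComponent g p f i y = chartCoframe n p ((extChartAt (𝓡 n) p).symm y)
      (riemannianGradient g f ((extChartAt (𝓡 n) p).symm y)) i := rfl

theorem sum_gradComponent_smul (g : SmoothMetric n M) (p : M) (f : M → ℝ) {y : 𝔼}
    (hy : y ∈ (extChartAt (𝓡 n) p).target) :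
    ∑ i, gradComponent g p f i y • chartFrame n p y (EuclideanSpace.single i 1) =
      (riemannianGradient g f ((extChartAt (𝓡 n) p).symm y) : 𝔼) := by
  simp only [gradComponent_eq_chartCoframe, ← map_smul]
  rw [← map_sum, sum_smul_single]
  exact chartFrame_chartCoframe p hy _

/-- The defining relation `g(∇f, ·) = df` in coordinates. Inverting the Gram matrix in it gives the
smoothness of the gradient components. -/
theorem gramMatrix_mulVec_gradComponent (g : SmoothMetric n M) (p : M) {f : M → ℝ}
    (hf : ContMDiff (𝓡 n) 𝓘(ℝ, ℝ) ∞ f) {y : 𝔼} (hy : y ∈ (extChartAt (𝓡 n) p).target) :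
    (gramMatrix g p y).mulVec (fun i => gradComponent g p f i y) =
      fun j => fderiv ℝ (inChart n p f) y (EuclideanSpace.single j 1) := by
  funext j
  rw [← differential_chartFrame p hf hy, ← metricAt_riemannianGradient g,
    ← sum_gradComponent_smul g p f hy]
  simp only [map_sum, map_smul, sum_apply, smul_apply,
    smul_eq_mul, dotProduct, Matrix.mulVec, gramMatrix_apply]
  refine Finset.sum_congr rfl fun i _ => ?_
  rw [mul_comm, metricAt_symm]

theorem contDiffOn_fderiv_inChart (p : M) {f : M → ℝ} (hf : ContMDiff (𝓡 n) 𝓘(ℝ, ℝ) ∞ f) (v : 𝔼) :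
    ContDiffOn ℝ ∞ (fun y => fderiv ℝ (inChart n p f) y v) (extChartAt (𝓡 n) p).target :=
  ((contDiffOn_inChart p hf).fderiv_of_isOpen (isOpen_extChartAt_target p) le_rfl).clm_apply
    contDiffOn_const

theorem contDiffOn_gradComponent (g : SmoothMetric n M) (p : M) {f : M → ℝ}
    (hf : ContMDiff (𝓡 n) 𝓘(ℝ, ℝ) ∞ f) (i : Fin n) :
    ContDiffOn ℝ ∞ (gradComponent g p f i) (extChartAt (𝓡 n) p).target := by
  have h1 : ContDiffOn ℝ ∞ (fun y => ∑ j, (gramMatrix g p y)⁻¹ i j *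
      fderiv ℝ (inChart n p f) y (EuclideanSpace.single j 1)) (extChartAt (𝓡 n) p).target :=
    ContDiffOn.sum fun j _ => (contDiffOn_inv (contDiffOn_gramMatrix g p)
      (fun y hy => (gramMatrix_det_pos g p hy).ne') i j).mul (contDiffOn_fderiv_inChart p hf _)
  refine h1.congr fun y hy => ?_
  have h2 := congrArg (gramMatrix g p y)⁻¹.mulVec (gramMatrix_mulVec_gradComponent g p hf hy)
  rw [Matrix.mulVec_mulVec, Matrix.nonsing_inv_mul _ (gramMatrix_det_pos g p hy).ne'.isUnit,
    Matrix.one_mulVec] at h2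
  exact congrFun h2 i

/-- The inner product of two gradients. -/
def gradInner (g : SmoothMetric n M) (f h : M → ℝ) (x : M) : ℝ :=
  g.inner x (riemannianGradient g f x) (riemannianGradient g h x)

/-- `⟨∇f, ∇h⟩ = dh(∇f)`, so the Gram matrix drops out and only `h` has to be smooth. -/
theorem gradInner_extChartAt_symm (g : SmoothMetric n M) (p : M) (f : M → ℝ) {h : M → ℝ}
    (hh : ContMDiff (𝓡 n) 𝓘(ℝ, ℝ) ∞ h) {y : 𝔼} (hy : y ∈ (extChartAt (𝓡 n) p).target) :
    gradInner g f h ((extChartAt (𝓡 n) p).symm y) = ∑ i, gradComponent g p f i y *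
      fderiv ℝ (inChart n p h) y (EuclideanSpace.single i 1) := by
  have h1 : gradInner g f h ((extChartAt (𝓡 n) p).symm y) =
      differential h ((extChartAt (𝓡 n) p).symm y)
        (riemannianGradient g f ((extChartAt (𝓡 n) p).symm y)) := by
    rw [← inner_riemannianGradient g, gradInner, g.symm]
  have h2 : differential h ((extChartAt (𝓡 n) p).symm y)
        (riemannianGradient g f ((extChartAt (𝓡 n) p).symm y)) =
      differential h ((extChartAt (𝓡 n) p).symm y) (∑ i, gradComponent g p f i y •
        chartFrame n p y (EuclideanSpace.single i 1) : 𝔼) :=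
    congrArg _ (sum_gradComponent_smul g p f hy).symm
  rw [h1, h2]
  have h3 := differential_chartFrame p hh hy (∑ i, gradComponent g p f i y •
        (EuclideanSpace.single i 1 : 𝔼))
  rw [map_sum, map_sum] at h3
  simp only [map_smul, smul_eq_mul] at h3
  exact h3

theorem continuous_gradInner (g : SmoothMetric n M) {f h : M → ℝ}
    (hf : ContMDiff (𝓡 n) 𝓘(ℝ, ℝ) ∞ f) (hh : ContMDiff (𝓡 n) 𝓘(ℝ, ℝ) ∞ h) :
    Continuous (gradInner g f h) := by
  rw [continuous_iff_continuousAt]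
  intro p
  have h1 : ContinuousOn (fun y => ∑ i, gradComponent g p f i y *
      fderiv ℝ (inChart n p h) y (EuclideanSpace.single i 1)) (extChartAt (𝓡 n) p).target :=
    continuousOn_finsetSum _ fun i _ => (contDiffOn_gradComponent g p hf i).continuousOn.mul
      (contDiffOn_fderiv_inChart p hh _).continuousOn
  have h2 : ContinuousOn (gradInner g f h) (extChartAt (𝓡 n) p).source := by
    refine (h1.comp (continuousOn_extChartAt p) (extChartAt (𝓡 n) p).mapsTo).congr fun x hx => ?_
    simp only [Function.comp]
    rw [← gradInner_extChartAt_symm g p f hh ((extChartAt (𝓡 n) p).map_source hx),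
      (extChartAt (𝓡 n) p).left_inv hx]
  exact h2.continuousAt (extChartAt_source_mem_nhds p)

/-! ### Change of charts -/

/-- The change of coordinates from the chart around `p` to the chart around `q`. -/
def chartTransition (n : ℕ) {M : Type*} [TopologicalSpace M]
    [ChartedSpace (EuclideanSpace ℝ (Fin n)) M] (p q : M) (y : EuclideanSpace ℝ (Fin n)) :
    EuclideanSpace ℝ (Fin n) :=
  extChartAt (𝓡 n) q ((extChartAt (𝓡 n) p).symm y)

theorem differentiableAt_chartTransition (p q : M) {y : 𝔼} (hy : y ∈ (extChartAt (𝓡 n) p).target)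
    (hq : (extChartAt (𝓡 n) p).symm y ∈ (extChartAt (𝓡 n) q).source) :
    DifferentiableAt ℝ (chartTransition n p q) y := by
  have : IsManifold (𝓡 n) 1 M := IsManifold.of_le (n := ∞) (by norm_num)
  rw [← mdifferentiableAt_iff_differentiableAt]
  refine MDifferentiableAt.comp (I' := 𝓡 n) y ?_ (mdifferentiableAt_extChartAt_symm p hy)
  exact mdifferentiableAt_extChartAt (by rwa [extChartAt_source] at hq)

theorem chartFrame_eq_comp (p q : M) {y : 𝔼} (hy : y ∈ (extChartAt (𝓡 n) p).target)
    (hq : (extChartAt (𝓡 n) p).symm y ∈ (extChartAt (𝓡 n) q).source) (v : 𝔼) :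
    chartFrame n p y v =
      chartFrame n q (chartTransition n p q y) (fderiv ℝ (chartTransition n p q) y v) := by
  have h1 := mfderiv_comp (I := 𝓡 n) (I' := 𝓡 n) (I'' := 𝓡 n) y
    (g := (extChartAt (𝓡 n) q).symm) (f := chartTransition n p q)
    (mdifferentiableAt_extChartAt_symm q ((extChartAt (𝓡 n) q).map_source hq))
    (mdifferentiableAt_iff_differentiableAt.2 (differentiableAt_chartTransition p q hy hq))
  have h2 : (extChartAt (𝓡 n) q).symm ∘ chartTransition n p q =ᶠ[𝓝 y]
      (extChartAt (𝓡 n) p).symm := by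
    have hc : ContinuousAt (extChartAt (𝓡 n) p).symm y :=
      (mdifferentiableAt_extChartAt_symm p hy).continuousAt
    filter_upwards [hc.preimage_mem_nhds ((isOpen_extChartAt_source q).mem_nhds hq)] with z hz
    exact (extChartAt (𝓡 n) q).left_inv hz
  rw [h2.mfderiv_eq, mfderiv_eq_fderiv] at h1
  exact DFunLike.congr_fun h1 v

/-- With `J` the Jacobian matrix of the transition, the frames are related by the chain rule, hence
`G_p = Jᵀ G_q J`. Taking determinants gives the factor `|det J|` for the density. -/
theorem gramMatrix_chartTransition (g : SmoothMetric n M) (p q : M) {y : 𝔼}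
    (hy : y ∈ (extChartAt (𝓡 n) p).target)
    (hq : (extChartAt (𝓡 n) p).symm y ∈ (extChartAt (𝓡 n) q).source) :
    gramMatrix g p y =
      (LinearMap.toMatrix (EuclideanSpace.basisFun (Fin n) ℝ).toBasis
        (EuclideanSpace.basisFun (Fin n) ℝ).toBasis
        (fderiv ℝ (chartTransition n p q) y).toLinearMap).transpose *
      gramMatrix g q (chartTransition n p q y) *
      LinearMap.toMatrix (EuclideanSpace.basisFun (Fin n) ℝ).toBasis
        (EuclideanSpace.basisFun (Fin n) ℝ).toBasis
        (fderiv ℝ (chartTransition n p q) y).toLinearMap := by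
  have hx : (extChartAt (𝓡 n) q).symm (chartTransition n p q y) = (extChartAt (𝓡 n) p).symm y :=
    (extChartAt (𝓡 n) q).left_inv hq
  ext i j
  rw [gramMatrix_apply, chartFrame_eq_comp p q hy hq, chartFrame_eq_comp p q hy hq,
    ← sum_smul_single (fderiv ℝ (chartTransition n p q) y (EuclideanSpace.single i 1)),
    ← sum_smul_single (fderiv ℝ (chartTransition n p q) y (EuclideanSpace.single j 1))]
  simp only [map_sum, map_smul, sum_apply, smul_apply,
    smul_eq_mul, Matrix.mul_apply, Matrix.transpose_apply, LinearMap.toMatrix_apply,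
    gramMatrix_apply, hx, Finset.sum_mul, OrthonormalBasis.coe_toBasis,
    EuclideanSpace.basisFun_apply, OrthonormalBasis.coe_toBasis_repr_apply,
    EuclideanSpace.basisFun_repr, ContinuousLinearMap.coe_coe]
  simp only [Finset.mul_sum]
  exact Finset.sum_congr rfl fun k _ => Finset.sum_congr rfl fun l _ => by ring

theorem volumeDensity_chartTransition (g : SmoothMetric n M) (p q : M) {y : 𝔼}
    (hy : y ∈ (extChartAt (𝓡 n) p).target)
    (hq : (extChartAt (𝓡 n) p).symm y ∈ (extChartAt (𝓡 n) q).source) :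
    volumeDensity g p y = |(fderiv ℝ (chartTransition n p q) y).det| *
      volumeDensity g q (chartTransition n p q y) := by
  rw [volumeDensity, gramMatrix_chartTransition g p q hy hq, Matrix.det_mul, Matrix.det_mul,
    Matrix.det_transpose, LinearMap.det_toMatrix, mul_right_comm, ← sq,
    Real.sqrt_mul (sq_nonneg _), Real.sqrt_sq_eq_abs]
  rfl

end ChartGeometry

/-! ### The Riemannian volume: agreement with chart volumes, local finiteness, positivity on open
sets -/

section Volume

variable {n : ℕ} {M : Type*} [TopologicalSpace M] [ChartedSpace (EuclideanSpace ℝ (Fin n)) M]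

local notation "𝔼" => EuclideanSpace ℝ (Fin n)

/-- The inverse chart is controlled only on the target, so measurability comes from its continuous
restriction to this open set. -/
theorem measurableSet_target_inter_preimage [MeasurableSpace M]
    [BorelSpace M] (p : M) {A : Set M} (hA : MeasurableSet A) :
    MeasurableSet ((extChartAt (𝓡 n) p).target ∩ (extChartAt (𝓡 n) p).symm ⁻¹' A) := by
  have h1 : Measurable ((extChartAt (𝓡 n) p).target.domRestrict (extChartAt (𝓡 n) p).symm) :=
    (continuousOn_iff_continuous_domRestrict.1 (continuousOn_extChartAt_symm p)).measurable
  have h2 := (isOpen_extChartAt_target (I := 𝓡 n) p).measurableSet.subtype_image (h1 hA)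
  convert h2 using 1
  rw [Set.domRestrict_eq, Set.preimage_comp, Subtype.image_preimage_coe]

variable [IsManifold (𝓡 n) ∞ M]

theorem aemeasurable_volumeDensity (g : SmoothMetric n M) (p : M) :
    AEMeasurable (fun y => ENNReal.ofReal (volumeDensity g p y))
      (volume.restrict (extChartAt (𝓡 n) p).target) :=
  ((contDiffOn_volumeDensity g p).continuousOn.aemeasurable
    (isOpen_extChartAt_target p).measurableSet).ennreal_ofReal

variable [MeasurableSpace M] [BorelSpace M]

theorem aemeasurable_extChartAt_symm (g : SmoothMetric n M) (p : M) :
    AEMeasurable (extChartAt (𝓡 n) p).symm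
      ((volume.restrict (extChartAt (𝓡 n) p).target).withDensity
        fun y => ENNReal.ofReal (volumeDensity g p y)) :=
  ((continuousOn_extChartAt_symm p).aemeasurable
    (isOpen_extChartAt_target p).measurableSet).mono_ac (withDensity_absolutelyContinuous _ _)

theorem chartVolume_apply (g : SmoothMetric n M) (p : M) {A : Set M} (hA : MeasurableSet A) :
    chartVolume g p A = ∫⁻ y in (extChartAt (𝓡 n) p).target ∩ (extChartAt (𝓡 n) p).symm ⁻¹' A,
      ENNReal.ofReal (volumeDensity g p y) := by
  have hS := measurableSet_target_inter_preimage (n := n) p hA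
  rw [chartVolume, ← lintegral_indicator_one hA,
    lintegral_map' (measurable_one.indicator hA).aemeasurable (aemeasurable_extChartAt_symm g p),
    lintegral_withDensity_eq_lintegral_mul₀' (aemeasurable_volumeDensity g p),
    ← lintegral_indicator (isOpen_extChartAt_target p).measurableSet, ← lintegral_indicator hS]
  · congr 1
    funext y
    by_cases h1 : y ∈ (extChartAt (𝓡 n) p).target
    · rw [Set.indicator_of_mem h1, Pi.mul_apply]
      by_cases h2 : (extChartAt (𝓡 n) p).symm y ∈ A
      · rw [Set.indicator_of_mem h2, Set.indicator_of_mem (show y ∈ _ ∩ _ from ⟨h1, h2⟩), Pi.one_apply, mul_one]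
      · rw [Set.indicator_of_notMem h2, Set.indicator_of_notMem fun h => h2 h.2, mul_zero]
    · rw [Set.indicator_of_notMem h1, Set.indicator_of_notMem fun h => h1 h.1]
  · exact (measurable_one.indicator hA).comp_aemeasurable (aemeasurable_extChartAt_symm g p)

theorem chartVolume_compl_source (g : SmoothMetric n M) (p : M) :
    chartVolume g p (extChartAt (𝓡 n) p).sourceᶜ = 0 := by
  rw [chartVolume_apply g p (isOpen_extChartAt_source p).measurableSet.compl]
  have : (extChartAt (𝓡 n) p).target ∩
      (extChartAt (𝓡 n) p).symm ⁻¹' (extChartAt (𝓡 n) p).sourceᶜ = ∅ := by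
    ext y
    simp only [Set.mem_inter_iff, Set.mem_preimage, Set.mem_compl_iff, Set.mem_empty_iff_false,
      iff_false, not_and, not_not]
    exact fun hy => (extChartAt (𝓡 n) p).map_target hy
  rw [this, Measure.restrict_empty, lintegral_zero_measure]

/-- The chart volumes agree on overlaps of charts. -/
theorem chartVolume_eq_of_subset (g : SmoothMetric n M) (p q : M) {A : Set M}
    (hA : MeasurableSet A) (hp : A ⊆ (extChartAt (𝓡 n) p).source)
    (hq : A ⊆ (extChartAt (𝓡 n) q).source) : chartVolume g p A = chartVolume g q A := by
  rw [chartVolume_apply g p hA, chartVolume_apply g q hA]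
  set S := (extChartAt (𝓡 n) p).target ∩ (extChartAt (𝓡 n) p).symm ⁻¹' A with hS
  set T := (extChartAt (𝓡 n) q).target ∩ (extChartAt (𝓡 n) q).symm ⁻¹' A with hT
  have himg : chartTransition n p q '' S = T := by
    ext z
    constructor
    · rintro ⟨y, ⟨hy, hyA⟩, rfl⟩
      refine ⟨(extChartAt (𝓡 n) q).map_source (hq hyA), ?_⟩
      simp only [chartTransition, Set.mem_preimage]
      rwa [(extChartAt (𝓡 n) q).left_inv (hq hyA)]
    · rintro ⟨hz, hzA⟩
      refine ⟨extChartAt (𝓡 n) p ((extChartAt (𝓡 n) q).symm z),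
        ⟨(extChartAt (𝓡 n) p).map_source (hp hzA), ?_⟩, ?_⟩
      · simp only [Set.mem_preimage]
        rwa [(extChartAt (𝓡 n) p).left_inv (hp hzA)]
      · simp only [chartTransition]
        rw [(extChartAt (𝓡 n) p).left_inv (hp hzA), (extChartAt (𝓡 n) q).right_inv hz]
  have hinj : Set.InjOn (chartTransition n p q) S := by
    rintro y ⟨hy, hyA⟩ z ⟨hz, hzA⟩ h
    have h1 := (extChartAt (𝓡 n) q).injOn (hq hyA) (hq hzA) h
    exact (extChartAt (𝓡 n) p).symm.injOn hy hz h1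
  -- Change of variables along the transition map; its Jacobian is the factor by which the two
  -- densities differ.
  rw [← himg, lintegral_image_eq_lintegral_abs_det_fderiv_mul volume
    (measurableSet_target_inter_preimage p hA)
    (fun y hy => (differentiableAt_chartTransition p q hy.1
      (hq hy.2)).hasFDerivAt.hasFDerivWithinAt) hinj]
  refine setLIntegral_congr_fun (measurableSet_target_inter_preimage p hA) fun y hy => ?_
  rw [volumeDensity_chartTransition g p q hy.1 (hq hy.2), ENNReal.ofReal_mul (abs_nonneg _)]

/-- On the domain of a chart, the Riemannian volume is the chart volume. -/
theorem riemannianVolume_apply_of_subset [SecondCountableTopology M] (g : SmoothMetric n M) (p : M)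
    {A : Set M} (hA : MeasurableSet A) (hp : A ⊆ (extChartAt (𝓡 n) p).source) :
    riemannianVolume g A = chartVolume g p A := by
  refine le_antisymm ?_ (Measure.le_iff'.1 (le_iSup (fun q => chartVolume g q) p) A)
  obtain ⟨s, hs, hcov⟩ := TopologicalSpace.countable_cover_nhds
    (fun x : M => extChartAt_source_mem_nhds (I := 𝓡 n) x)
  have hne : s.Nonempty := by
    have : p ∈ ⋃ x ∈ s, (extChartAt (𝓡 n) x).source := hcov ▸ Set.mem_univ p
    obtain ⟨x, hx, -⟩ := Set.mem_iUnion₂.1 this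
    exact ⟨x, hx⟩
  obtain ⟨c, rfl⟩ := hs.exists_eq_range hne
  -- A countable subcover, made disjoint, cuts `M` into measurable pieces that each lie in one chart
  -- domain.
  set B := disjointed fun i => (extChartAt (𝓡 n) (c i)).source with hB
  have hBm : ∀ i, MeasurableSet (B i) :=
    MeasurableSet.disjointed fun i => (isOpen_extChartAt_source _).measurableSet
  have hBs : ∀ i, B i ⊆ (extChartAt (𝓡 n) (c i)).source := fun i => disjointed_le _ i
  have hBU : ⋃ i, B i = Set.univ := by
    rw [hB, iUnion_disjointed, ← hcov, Set.biUnion_range]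
  have hBd : Pairwise (Function.onFun Disjoint B) := disjoint_disjointed _
  have hsum : ∀ (μ : Measure M) {C : Set M}, MeasurableSet C → μ C = ∑' i, μ (C ∩ B i) := by
    intro μ C hC
    rw [← measure_iUnion (fun i j hij => (hBd hij).mono Set.inter_subset_right
      Set.inter_subset_right) (fun i => hC.inter (hBm i)), ← Set.inter_iUnion, hBU, Set.inter_univ]
  -- The measure patched from the pieces dominates every chart volume, hence the supremum, and
  -- agrees with the chart volume at `p` on subsets of its domain.
  set ν : Measure M := Measure.sum fun i => (chartVolume g (c i)).restrict (B i) with hν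
  have hνa : ∀ {C : Set M}, MeasurableSet C → ν C = ∑' i, chartVolume g (c i) (C ∩ B i) := by
    intro C hC
    rw [hν, Measure.sum_apply _ hC]
    simp_rw [Measure.restrict_apply hC]
  have hle : riemannianVolume g ≤ ν := by
    refine iSup_le fun q => Measure.le_iff.2 fun C hC => ?_
    have hq := (isOpen_extChartAt_source (I := 𝓡 n) q).measurableSet
    have h1 : chartVolume g q C = chartVolume g q (C ∩ (extChartAt (𝓡 n) q).source) :=
      (measure_inter_conull' (measure_mono_null (fun x hx => hx.2)
        (chartVolume_compl_source g q))).symm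
    rw [h1, hsum _ (hC.inter hq), hνa hC]
    refine ENNReal.tsum_le_tsum fun i => ?_
    rw [chartVolume_eq_of_subset g q (c i) ((hC.inter hq).inter (hBm i)) (fun x hx => hx.1.2)
      fun x hx => hBs i hx.2]
    exact measure_mono fun x hx => ⟨hx.1.1, hx.2⟩
  refine (Measure.le_iff'.1 hle A).trans (le_of_eq ?_)
  rw [hνa hA, hsum _ hA]
  exact tsum_congr fun i => chartVolume_eq_of_subset g (c i) p (hA.inter (hBm i))
    (fun x hx => hBs i hx.2) fun x hx => hp hx.1

theorem riemannianVolume_restrict_source [SecondCountableTopology M] (g : SmoothMetric n M)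
    (p : M) :
    (riemannianVolume g).restrict (extChartAt (𝓡 n) p).source = chartVolume g p := by
  have hp := (isOpen_extChartAt_source (I := 𝓡 n) p).measurableSet
  ext A hA
  rw [Measure.restrict_apply hA, riemannianVolume_apply_of_subset g p (hA.inter hp)
    Set.inter_subset_right]
  exact measure_inter_conull' (measure_mono_null (fun x hx => hx.2) (chartVolume_compl_source g p))

/-- The integral of a function that vanishes off the domain of a chart. -/
theorem integral_riemannianVolume_eq [SecondCountableTopology M] (g : SmoothMetric n M)
    (p : M) {f : M → ℝ} (hf : AEStronglyMeasurable f (riemannianVolume g))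
    (h0 : ∀ x, x ∉ (extChartAt (𝓡 n) p).source → f x = 0) :
    ∫ x, f x ∂riemannianVolume g =
      ∫ y in (extChartAt (𝓡 n) p).target, volumeDensity g p y * inChart n p f y := by
  have hf' := hf.restrict (s := (extChartAt (𝓡 n) p).source)
  rw [riemannianVolume_restrict_source] at hf'
  rw [← setIntegral_eq_integral_of_forall_compl_eq_zero h0, riemannianVolume_restrict_source,
    chartVolume, integral_map (aemeasurable_extChartAt_symm g p) hf',
    integral_withDensity_eq_integral_toReal_smul₀ (aemeasurable_volumeDensity g p) (by simp)]
  refine setIntegral_congr_fun (isOpen_extChartAt_target p).measurableSet fun y hy => ?_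
  simp only [smul_eq_mul, inChart]
  rw [ENNReal.toReal_ofReal (volumeDensity_pos g p hy).le]

/-- Near `p`, the chart maps a neighbourhood into a compact subset of the target, where the
continuous density is bounded. -/
theorem riemannianVolume_isLocallyFinite [SecondCountableTopology M] (g : SmoothMetric n M) :
    IsLocallyFiniteMeasure (riemannianVolume g) := by
  refine ⟨fun p => ?_⟩
  have hopen := isOpen_extChartAt_target (I := 𝓡 n) p
  obtain ⟨K, hK, hKt, hKc⟩ := LocallyCompactSpace.local_compact_nhds _ _
    (hopen.mem_nhds (mem_extChartAt_target p))
  set U := (extChartAt (𝓡 n) p).source ∩ extChartAt (𝓡 n) p ⁻¹' interior K with hU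
  have hUo : IsOpen U := (continuousOn_extChartAt p).isOpen_inter_preimage
    (isOpen_extChartAt_source p) isOpen_interior
  refine ⟨U, hUo.mem_nhds ⟨mem_extChartAt_source p, mem_interior_iff_mem_nhds.2 hK⟩, ?_⟩
  rw [riemannianVolume_apply_of_subset g p hUo.measurableSet Set.inter_subset_left,
    chartVolume_apply g p hUo.measurableSet]
  have hsub : (extChartAt (𝓡 n) p).target ∩ (extChartAt (𝓡 n) p).symm ⁻¹' U ⊆ K := by
    rintro y ⟨hy, -, hyK⟩
    simp only [Set.mem_preimage] at hyK
    rw [(extChartAt (𝓡 n) p).right_inv hy] at hyK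
    exact interior_subset hyK
  obtain ⟨C, hC⟩ := hKc.exists_bound_of_continuousOn
    ((contDiffOn_volumeDensity g p).continuousOn.mono hKt)
  calc _ ≤ ∫⁻ y in K, ENNReal.ofReal (volumeDensity g p y) := lintegral_mono_set hsub
    _ ≤ ∫⁻ _ in K, ENNReal.ofReal C := by
        refine setLIntegral_mono measurable_const fun y hy => ENNReal.ofReal_le_ofReal ?_
        exact (le_abs_self _).trans (hC y hy)
    _ < ⊤ := by
        rw [setLIntegral_const]
        exact ENNReal.mul_lt_top ENNReal.ofReal_lt_top hKc.measure_lt_top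

/-- The density is positive on the target, so a null open set would yield a nonempty open Lebesgue
null set in the model space. -/
theorem riemannianVolume_isOpenPos [SecondCountableTopology M] (g : SmoothMetric n M) :
    (riemannianVolume g).IsOpenPosMeasure := by
  refine ⟨fun U hU ⟨p, hp⟩ h0 => ?_⟩
  have h1 : riemannianVolume g (U ∩ (extChartAt (𝓡 n) p).source) = 0 :=
    measure_mono_null Set.inter_subset_left h0
  have hUo : IsOpen (U ∩ (extChartAt (𝓡 n) p).source) := hU.inter (isOpen_extChartAt_source p)
  have hS := measurableSet_target_inter_preimage (n := n) p hUo.measurableSet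
  rw [riemannianVolume_apply_of_subset g p hUo.measurableSet Set.inter_subset_right,
    chartVolume_apply g p hUo.measurableSet, lintegral_eq_zero_iff'
    ((aemeasurable_volumeDensity g p).mono_measure
      (Measure.restrict_mono Set.inter_subset_left le_rfl))] at h1
  have hSo := (continuousOn_extChartAt_symm (I := 𝓡 n) p).isOpen_inter_preimage
    (isOpen_extChartAt_target p) hUo
  have h2 : volume ((extChartAt (𝓡 n) p).target ∩
      (extChartAt (𝓡 n) p).symm ⁻¹' (U ∩ (extChartAt (𝓡 n) p).source)) = 0 := by
    have h3 := (ae_restrict_iff' hS).1 h1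
    refine measure_mono_null (fun y hy => ?_) h3
    simp only [Set.mem_compl_iff, Set.mem_ofPred_eq]
    intro h
    have := h hy
    simp only [Pi.zero_apply, ENNReal.ofReal_eq_zero] at this
    exact absurd (volumeDensity_pos g p hy.1) (not_lt.2 this)
  refine hSo.measure_ne_zero volume ⟨extChartAt (𝓡 n) p p, mem_extChartAt_target p, ?_⟩ h2
  simp only [Set.mem_preimage]
  rw [extChartAt_to_inv]
  exact ⟨hp, mem_extChartAt_source p⟩

end Volume

/-! ### Green's formula, and independence of the Laplacian from the chart -/

section GreenFormula

/-- The product of a function continuous on an open set and a continuous function with support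
inside this set is continuous. -/
theorem continuous_mul_of_tsupport_subset {X : Type*} [TopologicalSpace X] {s : Set X}
    (hs : IsOpen s) {f h : X → ℝ} (hf : ContinuousOn f s) (hh : Continuous h)
    (hsupp : tsupport h ⊆ s) : Continuous fun x => f x * h x := by
  refine continuous_of_tsupport fun x hx => ?_
  have hx' : x ∈ tsupport h := tsupport_mul_subset_right hx
  exact (hf.continuousAt (hs.mem_nhds (hsupp hx'))).mul hh.continuousAt

variable {n : ℕ} {M : Type*} [TopologicalSpace M] [ChartedSpace (EuclideanSpace ℝ (Fin n)) M]

local notation "𝔼" => EuclideanSpace ℝ (Fin n)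

/-- A function supported in the domain of the chart around `p`, as a function on the model space. -/
def chartExtend (n : ℕ) {M : Type*} [TopologicalSpace M]
    [ChartedSpace (EuclideanSpace ℝ (Fin n)) M] (p : M) (χ : M → ℝ) :
    EuclideanSpace ℝ (Fin n) → ℝ :=
  (extChartAt (𝓡 n) p).target.indicator (inChart n p χ)

theorem isCompact_image_tsupport {p : M} {χ : M → ℝ} (hc : HasCompactSupport χ)
    (hs : tsupport χ ⊆ (extChartAt (𝓡 n) p).source) :
    IsCompact (extChartAt (𝓡 n) p '' tsupport χ) :=
  hc.isCompact.image_of_continuousOn ((continuousOn_extChartAt p).mono hs)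

theorem tsupport_chartExtend_subset {p : M} {χ : M → ℝ} (hc : HasCompactSupport χ)
    (hs : tsupport χ ⊆ (extChartAt (𝓡 n) p).source) :
    tsupport (chartExtend n p χ) ⊆ extChartAt (𝓡 n) p '' tsupport χ := by
  refine closure_minimal (fun y hy => ?_) (isCompact_image_tsupport hc hs).isClosed
  have hyt : y ∈ (extChartAt (𝓡 n) p).target := by
    by_contra h
    exact hy (Set.indicator_of_notMem h _)
  refine ⟨(extChartAt (𝓡 n) p).symm y, subset_tsupport _ ?_, (extChartAt (𝓡 n) p).right_inv hyt⟩
  have : chartExtend n p χ y ≠ 0 := hy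
  rwa [chartExtend, Set.indicator_of_mem hyt] at this

theorem tsupport_chartExtend_subset_target {p : M} {χ : M → ℝ} (hc : HasCompactSupport χ)
    (hs : tsupport χ ⊆ (extChartAt (𝓡 n) p).source) :
    tsupport (chartExtend n p χ) ⊆ (extChartAt (𝓡 n) p).target := by
  refine (tsupport_chartExtend_subset hc hs).trans ?_
  rintro _ ⟨x, hx, rfl⟩
  exact (extChartAt (𝓡 n) p).map_source (hs hx)

theorem hasCompactSupport_chartExtend {p : M} {χ : M → ℝ} (hc : HasCompactSupport χ)
    (hs : tsupport χ ⊆ (extChartAt (𝓡 n) p).source) : HasCompactSupport (chartExtend n p χ) :=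
  (isCompact_image_tsupport hc hs).of_isClosed_subset (isClosed_tsupport _)
    (tsupport_chartExtend_subset hc hs)

theorem chartExtend_eventuallyEq (p : M) (χ : M → ℝ) {y : 𝔼}
    (hy : y ∈ (extChartAt (𝓡 n) p).target) : chartExtend n p χ =ᶠ[𝓝 y] inChart n p χ := by
  filter_upwards [(isOpen_extChartAt_target p).mem_nhds hy] with z hz
  exact Set.indicator_of_mem hz _

theorem fderiv_chartExtend_eq_zero {p : M} {χ : M → ℝ} {y : 𝔼}
    (hy : y ∉ tsupport (chartExtend n p χ)) (v : 𝔼) : fderiv ℝ (chartExtend n p χ) y v = 0 := by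
  rw [(notMem_tsupport_iff_eventuallyEq.1 hy).fderiv_eq]
  simp

/-! ### Algebra of the differential -/

theorem differential_add {f h : M → ℝ} (hf : ContMDiff (𝓡 n) 𝓘(ℝ, ℝ) ∞ f)
    (hh : ContMDiff (𝓡 n) 𝓘(ℝ, ℝ) ∞ h) (x : M) :
    differential (n := n) (fun y => f y + h y) x = differential (n := n) f x + differential (n := n) h x := by
  have h1 := mfderiv_add (hf.mdifferentiableAt (by simp) (x := x))
    (hh.mdifferentiableAt (by simp) (x := x))
  ext v
  exact DFunLike.congr_fun h1 v

theorem differential_sub {f h : M → ℝ} (hf : ContMDiff (𝓡 n) 𝓘(ℝ, ℝ) ∞ f)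
    (hh : ContMDiff (𝓡 n) 𝓘(ℝ, ℝ) ∞ h) (x : M) :
    differential (n := n) (fun y => f y - h y) x = differential (n := n) f x - differential (n := n) h x := by
  have h1 := mfderiv_sub (hf.mdifferentiableAt (by simp) (x := x))
    (hh.mdifferentiableAt (by simp) (x := x))
  ext v
  exact DFunLike.congr_fun h1 v

theorem differential_mul {f h : M → ℝ} (hf : ContMDiff (𝓡 n) 𝓘(ℝ, ℝ) ∞ f)
    (hh : ContMDiff (𝓡 n) 𝓘(ℝ, ℝ) ∞ h) (x : M) (v : TangentSpace (𝓡 n) x) :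
    differential (n := n) (fun y => f y * h y) x v = f x * differential h x v + h x * differential f x v := by
  have h1 := (((hf.mdifferentiableAt (by simp) (x := x)).hasMFDerivAt).mul
    ((hh.mdifferentiableAt (by simp) (x := x)).hasMFDerivAt)).mfderiv
  exact DFunLike.congr_fun h1 v

theorem differential_eq_zero_of_notMem_tsupport {f : M → ℝ} {x : M} (hx : x ∉ tsupport f) :
    differential (n := n) f x = 0 := by
  have h1 : mfderiv (𝓡 n) 𝓘(ℝ, ℝ) f x = mfderiv (𝓡 n) 𝓘(ℝ, ℝ) (fun _ => (0 : ℝ)) x :=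
    (notMem_tsupport_iff_eventuallyEq.1 hx).mfderiv_eq
  rw [mfderiv_const] at h1
  ext v
  exact DFunLike.congr_fun h1 v

variable [IsManifold (𝓡 n) ∞ M]

theorem contDiff_chartExtend {p : M} {χ : M → ℝ} (hχ : ContMDiff (𝓡 n) 𝓘(ℝ, ℝ) ∞ χ)
    (hc : HasCompactSupport χ) (hs : tsupport χ ⊆ (extChartAt (𝓡 n) p).source) :
    ContDiff ℝ ∞ (chartExtend n p χ) := by
  rw [← contMDiff_iff_contDiff]
  refine contMDiff_of_tsupport fun y hy => ?_
  have hyt := tsupport_chartExtend_subset_target hc hs hy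
  rw [contMDiffAt_iff_contDiffAt]
  exact ((contDiffOn_inChart p hχ).contDiffAt
    ((isOpen_extChartAt_target p).mem_nhds hyt)).congr_of_eventuallyEq
      (chartExtend_eventuallyEq p χ hyt)

/-- The Laplacian computed in the coordinates of the chart around `p`. -/
def chartLaplacian (g : SmoothMetric n M) (p : M) (f : M → ℝ) (y : 𝔼) : ℝ :=
  (volumeDensity g p y)⁻¹ * ∑ i, fderiv ℝ (fun y => volumeDensity g p y * gradComponent g p f i y)
    y (EuclideanSpace.single i 1)

theorem contDiffOn_density_mul_gradComponent (g : SmoothMetric n M) (p : M) {f : M → ℝ}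
    (hf : ContMDiff (𝓡 n) 𝓘(ℝ, ℝ) ∞ f) (i : Fin n) :
    ContDiffOn ℝ ∞ (fun y => volumeDensity g p y * gradComponent g p f i y)
      (extChartAt (𝓡 n) p).target :=
  (contDiffOn_volumeDensity g p).mul (contDiffOn_gradComponent g p hf i)

theorem continuousOn_chartLaplacian (g : SmoothMetric n M) (p : M) {f : M → ℝ}
    (hf : ContMDiff (𝓡 n) 𝓘(ℝ, ℝ) ∞ f) :
    ContinuousOn (chartLaplacian g p f) (extChartAt (𝓡 n) p).target := by
  refine ((contDiffOn_volumeDensity g p).continuousOn.inv₀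
    fun y hy => (volumeDensity_pos g p hy).ne').mul (continuousOn_finsetSum _ fun i _ => ?_)
  have h : ContDiffOn ℝ ∞ _ _ := (contDiffOn_density_mul_gradComponent g p hf i).fderiv_of_isOpen
    (isOpen_extChartAt_target p) le_rfl
  exact (h.clm_apply contDiffOn_const).continuousOn

/-- Green's formula in a chart. -/
theorem integral_chartLaplacian (g : SmoothMetric n M) (p : M) {f χ : M → ℝ}
    (hf : ContMDiff (𝓡 n) 𝓘(ℝ, ℝ) ∞ f) (hχ : ContMDiff (𝓡 n) 𝓘(ℝ, ℝ) ∞ χ)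
    (hc : HasCompactSupport χ) (hs : tsupport χ ⊆ (extChartAt (𝓡 n) p).source) :
    ∫ y in (extChartAt (𝓡 n) p).target,
        volumeDensity g p y * (inChart n p χ y * chartLaplacian g p f y) =
      -∫ y in (extChartAt (𝓡 n) p).target,
        volumeDensity g p y * inChart n p (gradInner g f χ) y := by
  have hopen := isOpen_extChartAt_target (I := 𝓡 n) p
  set η := chartExtend n p χ with hη
  set W : Fin n → 𝔼 → ℝ := fun i y => volumeDensity g p y * gradComponent g p f i y with hW
  have hηs : ContDiff ℝ ∞ η := contDiff_chartExtend hχ hc hs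
  have hηc : HasCompactSupport η := hasCompactSupport_chartExtend hc hs
  have hηt : tsupport η ⊆ (extChartAt (𝓡 n) p).target := tsupport_chartExtend_subset_target hc hs
  have hWs : ∀ i, ContDiffOn ℝ ∞ (W i) (extChartAt (𝓡 n) p).target :=
    contDiffOn_density_mul_gradComponent g p hf
  have hW's : ∀ i v, ContinuousOn (fun y => fderiv ℝ (W i) y v) (extChartAt (𝓡 n) p).target := by
    intro i v
    have h : ContDiffOn ℝ ∞ _ _ := (hWs i).fderiv_of_isOpen hopen le_rfl
    exact (h.clm_apply contDiffOn_const).continuousOn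
  have hη's : ∀ v, Continuous fun y => fderiv ℝ η y v := fun v =>
    (hηs.continuous_fderiv (by simp)).clm_apply continuous_const
  have hη't : ∀ v, tsupport (fun y => fderiv ℝ η y v) ⊆ tsupport η := fun v =>
    closure_minimal (fun y hy => by
      by_contra h
      exact hy (fderiv_chartExtend_eq_zero h v)) (isClosed_tsupport _)
  have hη'c : ∀ v, HasCompactSupport fun y => fderiv ℝ η y v := fun v =>
    hηc.isCompact.of_isClosed_subset (isClosed_tsupport _) (hη't v)
  have int1 : ∀ i v, Integrable (fun y => fderiv ℝ (W i) y v * η y) := fun i v =>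
    (continuous_mul_of_tsupport_subset hopen (hW's i v) hηs.continuous
      hηt).integrable_of_hasCompactSupport hηc.mul_left
  have int2 : ∀ i v, Integrable (fun y => W i y * fderiv ℝ η y v) := fun i v =>
    (continuous_mul_of_tsupport_subset hopen (hWs i).continuousOn (hη's v)
      ((hη't v).trans hηt)).integrable_of_hasCompactSupport (hη'c v).mul_left
  have int3 : ∀ i, Integrable (fun y => W i y * η y) := fun i =>
    (continuous_mul_of_tsupport_subset hopen (hWs i).continuousOn hηs.continuous
      hηt).integrable_of_hasCompactSupport hηc.mul_left
  -- The functions `W i` are controlled only on the target. This is enough, because they enter in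
  -- products with `η` or its derivative, and differentiability is required only on `tsupport η`,
  -- which lies in the target.
  have hparts : ∀ i, ∫ y, W i y * fderiv ℝ η y (EuclideanSpace.single i 1) =
      -∫ y, fderiv ℝ (W i) y (EuclideanSpace.single i 1) * η y := fun i =>
    integral_mul_fderiv_eq_neg_fderiv_mul_of_integrable (int1 i _) (int2 i _) (int3 i)
      (fun y hy => ((hWs i).contDiffAt (hopen.mem_nhds (hηt hy))).differentiableAt (by simp))
      (fun y _ => (hηs.differentiable (by simp)).differentiableAt)
  have hL : ∫ y in (extChartAt (𝓡 n) p).target,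
        volumeDensity g p y * (inChart n p χ y * chartLaplacian g p f y) =
      ∫ y, ∑ i, fderiv ℝ (W i) y (EuclideanSpace.single i 1) * η y := by
    refine Eq.trans ?_ (setIntegral_eq_integral_of_forall_compl_eq_zero
      (s := (extChartAt (𝓡 n) p).target) fun y hy => ?_)
    · refine setIntegral_congr_fun hopen.measurableSet fun y hy => ?_
      have h1 : η y = inChart n p χ y := Set.indicator_of_mem hy _
      have h2 := (volumeDensity_pos g p hy).ne'
      simp only [h1, chartLaplacian, ← Finset.sum_mul]
      field_simp
      rfl
    · have : η y = 0 := Set.indicator_of_notMem hy _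
      simp [this]
  have hR : ∫ y in (extChartAt (𝓡 n) p).target,
        volumeDensity g p y * inChart n p (gradInner g f χ) y =
      ∫ y, ∑ i, W i y * fderiv ℝ η y (EuclideanSpace.single i 1) := by
    refine Eq.trans ?_ (setIntegral_eq_integral_of_forall_compl_eq_zero
      (s := (extChartAt (𝓡 n) p).target) fun y hy => ?_)
    · refine setIntegral_congr_fun hopen.measurableSet fun y hy => ?_
      have h1 : fderiv ℝ η y = fderiv ℝ (inChart n p χ) y :=
        (chartExtend_eventuallyEq p χ hy).fderiv_eq
      simp only [h1, inChart, hW]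
      rw [gradInner_extChartAt_symm g p f hχ hy, Finset.mul_sum]
      exact Finset.sum_congr rfl fun i _ => (mul_assoc _ _ _).symm
    · refine Finset.sum_eq_zero fun i _ => ?_
      rw [fderiv_chartExtend_eq_zero fun h => hy (hηt h), mul_zero]
  rw [hL, hR, integral_finsetSum _ fun i _ => int1 i _, integral_finsetSum _ fun i _ => int2 i _,
    ← Finset.sum_neg_distrib]
  exact Finset.sum_congr rfl fun i _ => by rw [hparts, neg_neg]

/-! ### Algebra of gradients -/

theorem gradInner_eq_differential (g : SmoothMetric n M) (f h : M → ℝ) (x : M) :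
    gradInner g f h x = differential h x (riemannianGradient g f x) := by
  rw [← inner_riemannianGradient g, gradInner, g.symm]

theorem gradInner_comm (g : SmoothMetric n M) (f h : M → ℝ) (x : M) :
    gradInner g f h x = gradInner g h f x := g.symm _ _ _

theorem gradInner_sub_right (g : SmoothMetric n M) (k : M → ℝ) {f h : M → ℝ}
    (hf : ContMDiff (𝓡 n) 𝓘(ℝ, ℝ) ∞ f) (hh : ContMDiff (𝓡 n) 𝓘(ℝ, ℝ) ∞ h) (x : M) :
    gradInner g k (fun y => f y - h y) x = gradInner g k f x - gradInner g k h x := by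
  simp only [gradInner_eq_differential, differential_sub hf hh, LinearMap.sub_apply]

theorem gradInner_mul_right (g : SmoothMetric n M) (k : M → ℝ) {f h : M → ℝ}
    (hf : ContMDiff (𝓡 n) 𝓘(ℝ, ℝ) ∞ f) (hh : ContMDiff (𝓡 n) 𝓘(ℝ, ℝ) ∞ h) (x : M) :
    gradInner g k (fun y => f y * h y) x = f x * gradInner g k h x + h x * gradInner g k f x := by
  simp only [gradInner_eq_differential, differential_mul hf hh]

theorem gradInner_sum_right (g : SmoothMetric n M) (k : M → ℝ) {ι : Type*} (s : Finset ι)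
    {f : ι → M → ℝ} (hf : ∀ i, ContMDiff (𝓡 n) 𝓘(ℝ, ℝ) ∞ (f i)) (x : M) :
    gradInner g k (fun y => ∑ i ∈ s, f i y) x = ∑ i ∈ s, gradInner g k (f i) x := by
  classical
  induction s using Finset.induction_on with
  | empty =>
    simp only [Finset.sum_empty, gradInner_eq_differential]
    rw [differential_eq_zero_of_notMem_tsupport (by simp [tsupport]), LinearMap.zero_apply]
  | insert i s hi ih =>
    simp only [Finset.sum_insert hi]
    rw [← ih, gradInner_eq_differential, gradInner_eq_differential, gradInner_eq_differential,
      differential_add (hf i) (contMDiff_finsetSum fun j _ => hf j), LinearMap.add_apply]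

theorem hasCompactSupport_gradInner (g : SmoothMetric n M) (f : M → ℝ) {χ : M → ℝ}
    (hc : HasCompactSupport χ) : HasCompactSupport (gradInner g f χ) :=
  hc.isCompact.of_isClosed_subset (isClosed_tsupport _) (closure_minimal (fun x hx => by
    by_contra h
    exact hx (by rw [gradInner_eq_differential, differential_eq_zero_of_notMem_tsupport h,
      LinearMap.zero_apply])) (isClosed_tsupport _))

/-! ### The Laplacian in an arbitrary chart, and Green's formula -/

variable [SecondCountableTopology M] [MeasurableSpace M] [BorelSpace M]

/-- The right-hand side does not involve the coordinates of `p`; this is what identifies the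
Laplacians of different charts. -/
theorem integral_mul_chartLaplacian (g : SmoothMetric n M) (p : M) {f χ : M → ℝ}
    (hf : ContMDiff (𝓡 n) 𝓘(ℝ, ℝ) ∞ f) (hχ : ContMDiff (𝓡 n) 𝓘(ℝ, ℝ) ∞ χ)
    (hc : HasCompactSupport χ) (hs : tsupport χ ⊆ (extChartAt (𝓡 n) p).source) :
    ∫ x, χ x * chartLaplacian g p f (extChartAt (𝓡 n) p x) ∂riemannianVolume g =
      -∫ x, gradInner g f χ x ∂riemannianVolume g := by
  have hcont : ContinuousOn (fun x => chartLaplacian g p f (extChartAt (𝓡 n) p x))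
      (extChartAt (𝓡 n) p).source :=
    (continuousOn_chartLaplacian g p hf).comp (continuousOn_extChartAt p)
      (extChartAt (𝓡 n) p).mapsTo
  have hcont' : Continuous fun x => χ x * chartLaplacian g p f (extChartAt (𝓡 n) p x) := by
    simpa only [mul_comm] using
      continuous_mul_of_tsupport_subset (isOpen_extChartAt_source p) hcont hχ.continuous hs
  rw [integral_riemannianVolume_eq g p hcont'.aestronglyMeasurable fun x hx => ?_,
    integral_riemannianVolume_eq g p (continuous_gradInner g hf hχ).aestronglyMeasurable
      fun x hx => ?_, ← integral_chartLaplacian g p hf hχ hc hs]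
  · refine setIntegral_congr_fun (isOpen_extChartAt_target p).measurableSet fun y hy => ?_
    simp only [inChart]
    rw [(extChartAt (𝓡 n) p).right_inv hy]
  · rw [gradInner_eq_differential, differential_eq_zero_of_notMem_tsupport fun h => hx (hs h),
      LinearMap.zero_apply]
  · rw [image_eq_zero_of_notMem_tsupport fun h => hx (hs h), zero_mul]

variable [T2Space M]

/-- The Laplacian may be computed in any chart. -/
theorem laplacian_eq_chartLaplacian (g : SmoothMetric n M) (p : M) {f : M → ℝ}
    (hf : ContMDiff (𝓡 n) 𝓘(ℝ, ℝ) ∞ f) {x : M} (hx : x ∈ (extChartAt (𝓡 n) p).source) :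
    laplacian g f x = chartLaplacian g p f (extChartAt (𝓡 n) p x) := by
  have := ChartedSpace.locallyCompactSpace 𝔼 M
  have := riemannianVolume_isLocallyFinite g
  have := riemannianVolume_isOpenPos g
  have hcont : ∀ q : M, ContinuousOn (fun x => chartLaplacian g q f (extChartAt (𝓡 n) q x))
      (extChartAt (𝓡 n) q).source := fun q =>
    (continuousOn_chartLaplacian g q hf).comp (continuousOn_extChartAt q)
      (extChartAt (𝓡 n) q).mapsTo
  set U := (extChartAt (𝓡 n) x).source ∩ (extChartAt (𝓡 n) p).source with hU
  have hUo : IsOpen U := (isOpen_extChartAt_source x).inter (isOpen_extChartAt_source p)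
  have h1 := (hcont x).mono (Set.inter_subset_left : U ⊆ _)
  have h2 := (hcont p).mono (Set.inter_subset_right : U ⊆ _)
  -- On the overlap both coordinate expressions have the same integral against every test function,
  -- so they agree almost everywhere and, by continuity, everywhere. No transformation law for the
  -- divergence has to be computed.
  have hae := hUo.ae_eq_zero_of_integral_contMDiff_smul_eq_zero (𝓡 n) (μ := riemannianVolume g)
    ((h1.sub h2).locallyIntegrableOn hUo.measurableSet) fun χ hχ hc hs => by
      have hsx := hs.trans Set.inter_subset_left
      have hsp := hs.trans Set.inter_subset_right
      have hint : ∀ q : M, tsupport χ ⊆ (extChartAt (𝓡 n) q).source →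
          Integrable (fun x => χ x * chartLaplacian g q f (extChartAt (𝓡 n) q x))
            (riemannianVolume g) := fun q hq => by
        have := continuous_mul_of_tsupport_subset (isOpen_extChartAt_source q) (hcont q)
          hχ.continuous hq
        simp only [mul_comm] at this
        exact this.integrable_of_hasCompactSupport hc.mul_right
      simp only [smul_eq_mul, Pi.sub_apply, mul_sub]
      rw [integral_sub (hint x hsx) (hint p hsp), integral_mul_chartLaplacian g x hf hχ hc hsx,
        integral_mul_chartLaplacian g p hf hχ hc hsp, sub_self]
  have heq := Measure.eqOn_open_of_ae_eq (μ := riemannianVolume g) (U := U)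
    (f := fun z => chartLaplacian g x f (extChartAt (𝓡 n) x z))
    (g := fun z => chartLaplacian g p f (extChartAt (𝓡 n) p z)) (by
      rw [EventuallyEq, ae_restrict_iff' hUo.measurableSet]
      filter_upwards [hae] with z hz hzU
      exact sub_eq_zero.1 (hz hzU)) hUo h1 h2
  -- By definition, `laplacian g f x` is the coordinate Laplacian of the chart around `x`, evaluated
  -- at its centre.
  exact heq ⟨mem_extChartAt_source x, hx⟩

theorem continuous_laplacian (g : SmoothMetric n M) {f : M → ℝ}
    (hf : ContMDiff (𝓡 n) 𝓘(ℝ, ℝ) ∞ f) : Continuous (laplacian g f) := by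
  rw [continuous_iff_continuousAt]
  intro p
  have h : ContinuousOn (laplacian g f) (extChartAt (𝓡 n) p).source :=
    ((continuousOn_chartLaplacian g p hf).comp (continuousOn_extChartAt p)
      (extChartAt (𝓡 n) p).mapsTo).congr fun x hx => laplacian_eq_chartLaplacian g p hf hx
  exact h.continuousAt (extChartAt_source_mem_nhds p)

/-- Green's formula for a function supported in the domain of a chart. -/
theorem integral_mul_laplacian_of_tsupport_subset (g : SmoothMetric n M) (p : M) {f χ : M → ℝ}
    (hf : ContMDiff (𝓡 n) 𝓘(ℝ, ℝ) ∞ f) (hχ : ContMDiff (𝓡 n) 𝓘(ℝ, ℝ) ∞ χ)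
    (hc : HasCompactSupport χ) (hs : tsupport χ ⊆ (extChartAt (𝓡 n) p).source) :
    ∫ x, χ x * laplacian g f x ∂riemannianVolume g =
      -∫ x, gradInner g f χ x ∂riemannianVolume g := by
  rw [← integral_mul_chartLaplacian g p hf hχ hc hs]
  congr 1
  funext x
  by_cases hx : x ∈ (extChartAt (𝓡 n) p).source
  · rw [laplacian_eq_chartLaplacian g p hf hx]
  · rw [image_eq_zero_of_notMem_tsupport fun h => hx (hs h), zero_mul, zero_mul]

/-- Green's formula: `∫ χ Δf = -∫ ⟨∇f, ∇χ⟩` for compactly supported `χ`. -/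
theorem integral_mul_laplacian (g : SmoothMetric n M) {f χ : M → ℝ}
    (hf : ContMDiff (𝓡 n) 𝓘(ℝ, ℝ) ∞ f) (hχ : ContMDiff (𝓡 n) 𝓘(ℝ, ℝ) ∞ χ)
    (hc : HasCompactSupport χ) :
    ∫ x, χ x * laplacian g f x ∂riemannianVolume g =
      -∫ x, gradInner g f χ x ∂riemannianVolume g := by
  have := ChartedSpace.locallyCompactSpace 𝔼 M
  have := riemannianVolume_isLocallyFinite g
  -- Only finitely many members of the partition meet the compact support of `χ`, so `χ` is a finite
  -- sum of functions each supported in a chart domain.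
  obtain ⟨ρ, hρ⟩ := SmoothPartitionOfUnity.exists_isSubordinate_chartAt_source (𝓡 n) M
  have hfin := ρ.locallyFinite.finite_nonempty_inter_compact hc.isCompact
  set s := hfin.toFinset with hs
  have hsum : ∀ x, χ x = ∑ i ∈ s, ρ i x * χ x := by
    intro x
    by_cases hx : χ x = 0
    · simp [hx]
    · rw [← Finset.sum_mul, ← finsum_eq_sum_of_support_subset (s := s) (fun i => ρ i x),
        ρ.sum_eq_one (Set.mem_univ x), one_mul]
      intro i hi
      rw [hs, Set.Finite.coe_toFinset]
      exact ⟨x, hi, subset_tsupport _ hx⟩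
  set ξ : M → M → ℝ := fun i x => ρ i x * χ x with hξ
  have hξs : ∀ i, ContMDiff (𝓡 n) 𝓘(ℝ, ℝ) ∞ (ξ i) := fun i => (ρ i).contMDiff.mul hχ
  have hξc : ∀ i, HasCompactSupport (ξ i) := fun i => hc.mul_left
  have hξt : ∀ i, tsupport (ξ i) ⊆ (extChartAt (𝓡 n) i).source := fun i => by
    rw [extChartAt_source]
    exact tsupport_mul_subset_left.trans (hρ i)
  have e1 : χ = fun x => ∑ i ∈ s, ξ i x := funext hsum
  have e2 : ∀ x, χ x * laplacian g f x = ∑ i ∈ s, ξ i x * laplacian g f x := by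
    intro x
    rw [← Finset.sum_mul, ← hsum]
  have e3 : ∀ x, gradInner g f χ x = ∑ i ∈ s, gradInner g f (ξ i) x := by
    intro x
    rw [← gradInner_sum_right g f s hξs, ← e1]
  simp only [e2, e3]
  rw [integral_finsetSum, integral_finsetSum, ← Finset.sum_neg_distrib]
  · exact Finset.sum_congr rfl fun i _ =>
      integral_mul_laplacian_of_tsupport_subset g i hf (hξs i) (hξc i) (hξt i)
  · exact fun i _ => (continuous_gradInner g hf (hξs i)).integrable_of_hasCompactSupport
      (hasCompactSupport_gradInner g f (hξc i))
  · exact fun i _ => ((hξs i).continuous.mul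
      (continuous_laplacian g hf)).integrable_of_hasCompactSupport (hξc i).mul_right

/-- Green's formula for the drift Laplacian. -/
theorem integral_driftLaplacian (g : SmoothMetric n M) {φ f ψ : M → ℝ}
    (hφ : ContMDiff (𝓡 n) 𝓘(ℝ, ℝ) ∞ φ) (hf : ContMDiff (𝓡 n) 𝓘(ℝ, ℝ) ∞ f)
    (hψ : ContMDiff (𝓡 n) 𝓘(ℝ, ℝ) ∞ ψ) (hc : HasCompactSupport ψ) :
    ∫ x, (laplacian g f x - gradInner g f φ x) * ψ x * Real.exp (-φ x) ∂riemannianVolume g =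
      -∫ x, gradInner g f ψ x * Real.exp (-φ x) ∂riemannianVolume g := by
  have := riemannianVolume_isLocallyFinite g
  have hexp : ContMDiff (𝓡 n) 𝓘(ℝ, ℝ) ∞ fun x => Real.exp (-φ x) :=
    (Real.contDiff_exp.contMDiff.comp hφ.neg :)
  have hdexp : ∀ x, gradInner g f (fun x => Real.exp (-φ x)) x =
      -(Real.exp (-φ x) * gradInner g f φ x) := by
    intro x
    rw [gradInner_eq_differential, gradInner_eq_differential]
    have h1 : HasMFDerivAt (𝓡 n) 𝓘(ℝ, ℝ) φ x (mfderiv (𝓡 n) 𝓘(ℝ, ℝ) φ x) :=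
      (hφ.mdifferentiableAt (by simp)).hasMFDerivAt
    have h2 : HasFDerivAt (fun t : ℝ => Real.exp (-t))
        (ContinuousLinearMap.toSpanSingleton ℝ (-Real.exp (-φ x))) (φ x) := by
      have := ((hasDerivAt_neg (φ x)).exp).hasFDerivAt
      simpa using this
    have h3 := (h2.hasMFDerivAt.comp x h1).mfderiv
    have h4 := DFunLike.congr_fun h3 (riemannianGradient g f x)
    refine Eq.trans h4 ?_
    refine Eq.trans (?_ : _ = (differential φ x (riemannianGradient g f x)) •
      (-Real.exp (-φ x))) (by rw [smul_eq_mul]; ring)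
    rfl
  -- Green's formula is applied to `ψ e^{-φ}`; the derivative of the weight produces exactly the
  -- drift term.
  have hχ : ContMDiff (𝓡 n) 𝓘(ℝ, ℝ) ∞ fun x => ψ x * Real.exp (-φ x) := hψ.mul hexp
  have key := integral_mul_laplacian g hf hχ hc.mul_right
  have hG : ∀ x, gradInner g f (fun x => ψ x * Real.exp (-φ x)) x =
      gradInner g f ψ x * Real.exp (-φ x) -
        gradInner g f φ x * ψ x * Real.exp (-φ x) := by
    intro x
    rw [gradInner_mul_right g f hψ hexp, hdexp]
    ring
  have i1 : Integrable (fun x => ψ x * Real.exp (-φ x) * laplacian g f x) (riemannianVolume g) :=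
    (hχ.continuous.mul (continuous_laplacian g hf)).integrable_of_hasCompactSupport
      hc.mul_right.mul_right
  have i2 : Integrable (fun x => gradInner g f ψ x * Real.exp (-φ x)) (riemannianVolume g) :=
    ((continuous_gradInner g hf hψ).mul hexp.continuous).integrable_of_hasCompactSupport
      (hasCompactSupport_gradInner g f hc).mul_right
  have i3 : Integrable (fun x => gradInner g f φ x * ψ x * Real.exp (-φ x))
      (riemannianVolume g) :=
    (((continuous_gradInner g hf hφ).mul hψ.continuous).mul
      hexp.continuous).integrable_of_hasCompactSupport hc.mul_left.mul_right
  simp only [hG] at key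
  rw [integral_sub i2 i3] at key
  have e1 : ∀ x, (laplacian g f x - gradInner g f φ x) * ψ x * Real.exp (-φ x) =
      ψ x * Real.exp (-φ x) * laplacian g f x - gradInner g f φ x * ψ x * Real.exp (-φ x) := by
    intro x; ring
  simp only [e1]
  rw [integral_sub i1 i3, key]
  ring

end GreenFormula

/-! ### Cauchy–Schwarz, and the weak time derivative of an `L²`-valued curve -/

section Integration

/-- Hölder with exponents 1/2 and 1/2 in `ℝ≥0∞`, so that no integrability is presupposed. It serves
both the `L²` and the gradient part of the Sobolev norm. -/
theorem lintegral_enorm_le_of_abs_le_sqrt {X : Type*} [MeasurableSpace X] {μ : Measure X}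
    {p q h : X → ℝ} (hp : AEMeasurable p μ) (hq : AEMeasurable q μ)
    (hh : ∀ x, |h x| ≤ √(p x) * √(q x)) :
    ∫⁻ x, ‖h x‖ₑ ∂μ ≤ (∫⁻ x, ENNReal.ofReal (p x) ∂μ) ^ (1 / 2 : ℝ) *
      (∫⁻ x, ENNReal.ofReal (q x) ∂μ) ^ (1 / 2 : ℝ) := by
  refine le_trans (lintegral_mono fun x => ?_) (ENNReal.lintegral_mul_norm_pow_le
    hp.ennreal_ofReal hq.ennreal_ofReal (by norm_num) (by norm_num) (by norm_num))
  have key : ∀ r : ℝ, ENNReal.ofReal (√r) = ENNReal.ofReal r ^ (1 / 2 : ℝ) := by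
    intro r
    rcases le_total 0 r with hr | hr
    · rw [Real.sqrt_eq_rpow, ENNReal.ofReal_rpow_of_nonneg hr (by norm_num)]
    · rw [Real.sqrt_eq_zero_of_nonpos hr, ENNReal.ofReal_of_nonpos hr, ENNReal.ofReal_zero,
        ENNReal.zero_rpow_of_pos (by norm_num)]
  rw [Real.enorm_eq_ofReal_abs, ← key, ← key, ← ENNReal.ofReal_mul (Real.sqrt_nonneg _)]
  exact ENNReal.ofReal_le_ofReal (hh x)

variable {F : Type*} [NormedAddCommGroup F] [InnerProductSpace ℝ F]

theorem integrable_inner_of_memLp {X : Type*} [MeasurableSpace X] {μ : Measure X} {v w : X → F}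
    (hv : MemLp v 2 μ) (hw : MemLp w 2 μ) : Integrable (fun x => inner ℝ (w x) (v x)) μ := by
  refine Integrable.mono' ((((memLp_two_iff_integrable_sq_norm hw.1).1 hw).add
    ((memLp_two_iff_integrable_sq_norm hv.1).1 hv))) (hw.1.inner hv.1) (Eventually.of_forall
    fun x => ?_)
  have h1 := norm_inner_le_norm (𝕜 := ℝ) (w x) (v x)
  simp only [Pi.add_apply]
  nlinarith [sq_nonneg (‖w x‖ - ‖v x‖), sq_nonneg ‖w x‖, sq_nonneg ‖v x‖]

variable [CompleteSpace F] [SecondCountableTopology F] {X : Type*} [TopologicalSpace X]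
  [MeasurableSpace X] [OpensMeasurableSpace X] {μ : Measure X} {a b : ℝ} {u : X → ℝ → F}

/-- Extending `u` beyond `[a, b]` by its end values gives a jointly continuous function, whose time
derivative is jointly measurable. It agrees with the one-sided derivative except at the end points,
a null set of times. -/
theorem aestronglyMeasurable_derivWithin
    (hc : ContinuousOn (fun q : X × ℝ => u q.1 q.2) (Set.univ ×ˢ Set.Icc a b)) (hab : a < b)
    {T : Set ℝ} (hT : T ⊆ Set.Icc a b) (hTm : MeasurableSet T) :
    AEStronglyMeasurable (fun q : ℝ × X => derivWithin (u q.2) (Set.Icc a b) q.1)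
      ((volume.restrict T).prod μ) := by
  set w : X → ℝ → F := fun x τ => u x (Set.projIcc a b hab.le τ) with hw
  have hwc : Continuous w.uncurry := by
    rw [← continuousOn_univ]
    have h1 : Continuous fun q : X × ℝ => (q.1, (Set.projIcc a b hab.le q.2 : ℝ)) :=
      continuous_fst.prodMk (continuous_subtype_val.comp
        (continuous_projIcc.comp continuous_snd))
    exact hc.comp h1.continuousOn fun q _ => ⟨Set.mem_univ _, Subtype.coe_prop _⟩
  have hm : StronglyMeasurable fun q : X × ℝ => deriv (w q.1) q.2 :=
    stronglyMeasurable_deriv_with_param hwc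
  have hm' : StronglyMeasurable fun q : ℝ × X => deriv (w q.2) q.1 :=
    hm.comp_measurable measurable_swap
  refine ⟨_, hm', ?_⟩
  have hae : ∀ᵐ τ ∂(volume.restrict T), τ ∈ Set.Ioo a b := by
    rw [ae_restrict_iff' hTm]
    have ha : ∀ᵐ τ : ℝ, τ ≠ a := by simp [ae_iff, measure_singleton]
    have hb : ∀ᵐ τ : ℝ, τ ≠ b := by simp [ae_iff, measure_singleton]
    filter_upwards [ha, hb] with τ h1 h2 h3
    exact ⟨lt_of_le_of_ne (hT h3).1 (Ne.symm h1), lt_of_le_of_ne (hT h3).2 h2⟩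
  have hae' : ∀ᵐ q : ℝ × X ∂((volume.restrict T).prod μ), q.1 ∈ Set.Ioo a b :=
    Measure.quasiMeasurePreserving_fst.ae hae
  filter_upwards [hae'] with q hq
  rw [derivWithin_of_mem_nhds (Icc_mem_nhds hq.1 hq.2)]
  refine EventuallyEq.deriv_eq ?_
  filter_upwards [Icc_mem_nhds hq.1 hq.2] with τ hτ
  simp only [hw]
  rw [Set.projIcc_of_mem _ hτ]

/-- The `L²`-valued curve `u` has the weak derivative `∂ₜu`. -/
theorem integral_inner_sub_eq [SFinite μ]
    (hc : ContinuousOn (fun q : X × ℝ => u q.1 q.2) (Set.univ ×ˢ Set.Icc a b)) (hab : a < b)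
    (hd : ∀ x, ContDiffOn ℝ 1 (u x) (Set.Icc a b))
    (hL : ∀ t ∈ Set.Icc a b, MemLp (fun x => derivWithin (u x) (Set.Icc a b) t) 2 μ) {C : ℝ}
    (hC : ∀ t ∈ Set.Icc a b, ∫ x, ‖derivWithin (u x) (Set.Icc a b) t‖ ^ 2 ∂μ ≤ C)
    {w : X → F} (hw : MemLp w 2 μ) {s t : ℝ} (hs : s ∈ Set.Icc a b) (ht : t ∈ Set.Icc a b) :
    ∫ x, inner ℝ (w x) (u x t - u x s) ∂μ =
      ∫ τ in s..t, ∫ x, inner ℝ (w x) (derivWithin (u x) (Set.Icc a b) τ) ∂μ := by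
  have hsub : Set.uIcc s t ⊆ Set.Icc a b := Set.uIcc_subset_Icc hs ht
  have hsub' : Set.uIoc s t ⊆ Set.Icc a b := Set.uIoc_subset_uIcc.trans hsub
  have : IsFiniteMeasure (volume.restrict (Set.uIoc s t)) :=
    inferInstanceAs (IsFiniteMeasure (volume.restrict (Set.Ioc (min s t) (max s t))))
  have hmem : ∀ᵐ τ ∂(volume.restrict (Set.uIoc s t)), τ ∈ Set.Icc a b := by
    filter_upwards [ae_restrict_mem measurableSet_uIoc] with τ hτ using hsub' hτ
  have hmeas : AEStronglyMeasurable
      (fun q : ℝ × X => inner ℝ (w q.2) (derivWithin (u q.2) (Set.Icc a b) q.1))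
      ((volume.restrict (Set.uIoc s t)).prod μ) :=
    hw.1.comp_snd.inner (aestronglyMeasurable_derivWithin hc hab hsub' measurableSet_uIoc)
  have hint : Integrable
      (Function.uncurry fun (τ : ℝ) (x : X) => inner ℝ (w x) (derivWithin (u x) (Set.Icc a b) τ))
      ((volume.restrict (Set.uIoc s t)).prod μ) := by
    refine (integrable_prod_iff hmeas).2 ⟨?_, ?_⟩
    · filter_upwards [hmem] with τ hτ using integrable_inner_of_memLp (hL τ hτ) hw
    -- From `|⟨w, u_t⟩| ≤ ‖w‖² + ‖u_t‖²`, the uniform bound `C` makes the spatial integrals bounded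
    -- on a finite time interval, which gives the integrability that Fubini needs.
    · refine Integrable.mono' (g := fun _ => (∫ x, ‖w x‖ ^ 2 ∂μ) + C) (integrable_const _)
        hmeas.norm.integral_prod_right' ?_
      filter_upwards [hmem] with τ hτ
      rw [Real.norm_of_nonneg (integral_nonneg fun x => norm_nonneg _)]
      have i1 := (memLp_two_iff_integrable_sq_norm hw.1).1 hw
      have i2 := (memLp_two_iff_integrable_sq_norm (hL τ hτ).1).1 (hL τ hτ)
      refine le_trans (integral_mono (integrable_inner_of_memLp (hL τ hτ) hw).norm (i1.add i2)
        fun x => ?_) ?_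
      · have h1 := norm_inner_le_norm (𝕜 := ℝ) (w x) (derivWithin (u x) (Set.Icc a b) τ)
        simp only [Pi.add_apply]
        nlinarith [sq_nonneg (‖w x‖ - ‖derivWithin (u x) (Set.Icc a b) τ‖), sq_nonneg ‖w x‖,
          sq_nonneg ‖derivWithin (u x) (Set.Icc a b) τ‖]
      · rw [integral_add' i1 i2]
        gcongr
        exact hC τ hτ
  rw [intervalIntegral_integral_swap hint]
  congr 1
  funext x
  have hcd : ContDiffOn ℝ 1 (u x) (Set.uIcc s t) := (hd x).mono hsub
  have hcw : ContinuousOn (derivWithin (u x) (Set.Icc a b)) (Set.Icc a b) :=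
    (hd x).continuousOn_derivWithin (uniqueDiffOn_Icc hab) le_rfl
  have hii : IntervalIntegrable (derivWithin (u x) (Set.Icc a b)) volume s t :=
    (hcw.mono hsub).intervalIntegrable
  have h1 := (innerSL ℝ (w x)).intervalIntegral_comp_comm hii
  simp only [innerSL_apply_apply] at h1
  rw [h1]
  congr 1
  have h2 := intervalIntegral.integral_eq_sub_of_hasDeriv_right (hcd.continuousOn)
    (f' := derivWithin (u x) (Set.Icc a b)) (fun τ hτ => ?_) hii
  · exact h2.symm
  · have hτ' : τ ∈ Set.Ioo a b :=
      ⟨lt_of_le_of_lt (le_min hs.1 ht.1) hτ.1, lt_of_lt_of_le hτ.2 (max_le hs.2 ht.2)⟩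
    have h3 : DifferentiableWithinAt ℝ (u x) (Set.Icc a b) τ :=
      (hd x).differentiableOn one_ne_zero τ (Set.Ioo_subset_Icc_self hτ')
    exact (h3.hasDerivWithinAt.hasDerivAt (Icc_mem_nhds hτ'.1 hτ'.2)).hasDerivWithinAt

end Integration

/-! ### The weighted measure and the weak form of the drift Laplacian on `W^{1,2}_φ` -/

section WeightedSpace

variable {n N : ℕ} {M : Type*} [TopologicalSpace M] [ChartedSpace (EuclideanSpace ℝ (Fin n)) M]

theorem contMDiff_component {v : M → EuclideanSpace ℝ (Fin N)}
    (hv : ContMDiff (𝓡 n) (𝓡 N) ∞ v) (k : Fin N) :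
    ContMDiff (𝓡 n) 𝓘(ℝ, ℝ) ∞ fun x => v x k :=
  (EuclideanSpace.proj (𝕜 := ℝ) k).contMDiff.comp hv

variable [IsManifold (𝓡 n) ∞ M]

/-- `⟨∇v, ∇w⟩`, summed over the components. -/
def gradPair (g : SmoothMetric n M) (v w : M → EuclideanSpace ℝ (Fin N)) (x : M) : ℝ :=
  ∑ k, gradInner g (fun y => v y k) (fun y => w y k) x

theorem gradPair_comm (g : SmoothMetric n M) (v w : M → EuclideanSpace ℝ (Fin N)) (x : M) :
    gradPair g v w x = gradPair g w v x :=
  Finset.sum_congr rfl fun _ _ => gradInner_comm g _ _ x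

theorem continuous_gradPair (g : SmoothMetric n M) {v w : M → EuclideanSpace ℝ (Fin N)}
    (hv : ContMDiff (𝓡 n) (𝓡 N) ∞ v) (hw : ContMDiff (𝓡 n) (𝓡 N) ∞ w) :
    Continuous (gradPair g v w) :=
  continuous_finsetSum _ fun k _ =>
    continuous_gradInner g (contMDiff_component hv k) (contMDiff_component hw k)

theorem continuous_gradNormSq (g : SmoothMetric n M) {v : M → EuclideanSpace ℝ (Fin N)}
    (hv : ContMDiff (𝓡 n) (𝓡 N) ∞ v) : Continuous (gradNormSq g v) :=
  continuous_gradPair g hv hv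

theorem gradPair_sub_right (g : SmoothMetric n M) {u v w : M → EuclideanSpace ℝ (Fin N)}
    (hv : ContMDiff (𝓡 n) (𝓡 N) ∞ v) (hw : ContMDiff (𝓡 n) (𝓡 N) ∞ w) (x : M) :
    gradPair g u (fun y => v y - w y) x = gradPair g u v x - gradPair g u w x := by
  rw [gradPair, gradPair, gradPair, ← Finset.sum_sub_distrib]
  exact Finset.sum_congr rfl fun k _ =>
    gradInner_sub_right g _ (contMDiff_component hv k) (contMDiff_component hw k) x

theorem gradInner_self_nonneg (g : SmoothMetric n M) (f : M → ℝ) (x : M) :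
    0 ≤ gradInner g f f x := by
  by_cases h : riemannianGradient g f x = 0
  · simp [gradInner, h]
  · exact (g.pos x _ h).le

theorem gradNormSq_nonneg (g : SmoothMetric n M) (v : M → EuclideanSpace ℝ (Fin N)) (x : M) :
    0 ≤ gradNormSq g v x :=
  Finset.sum_nonneg fun _ _ => gradInner_self_nonneg g _ x

theorem abs_gradInner_le (g : SmoothMetric n M) (f h : M → ℝ) (x : M) :
    |gradInner g f h x| ≤ √(gradInner g f f x) * √(gradInner g h h x) := by
  have hs : ∀ v, 0 ≤ metricForm g x v v := fun v => by
    by_cases h : v = 0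
    · simp [h]
    · exact (g.pos x v h).le
  have h1 := LinearMap.BilinForm.apply_sq_le_of_symm (metricForm g x) hs
    ⟨fun v w => g.symm x v w⟩ (riemannianGradient g f x) (riemannianGradient g h x)
  rw [← Real.sqrt_mul (gradInner_self_nonneg g f x)]
  exact Real.abs_le_sqrt h1

/-- Cauchy–Schwarz twice: for the metric in each component, then for the sum over components. -/
theorem abs_gradPair_le (g : SmoothMetric n M) (v w : M → EuclideanSpace ℝ (Fin N)) (x : M) :
    |gradPair g v w x| ≤ √(gradNormSq g v x) * √(gradNormSq g w x) :=
  (Finset.abs_sum_le_sum_abs _ _).trans ((Finset.sum_le_sum fun _ _ => abs_gradInner_le g _ _ x).trans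
    (Real.sum_sqrt_mul_sqrt_le _ (fun _ => gradInner_self_nonneg g _ x)
      fun _ => gradInner_self_nonneg g _ x))

variable [MeasurableSpace M]

/-- The measure `e^{-φ} dvol`. -/
def weightedVolume (g : SmoothMetric n M) (φ : M → ℝ) : Measure M :=
  (riemannianVolume g).withDensity fun x => ENNReal.ofReal (Real.exp (-φ x))

variable [BorelSpace M]

theorem integral_weightedVolume (g : SmoothMetric n M) {φ : M → ℝ} (hφ : Continuous φ)
    (f : M → ℝ) : ∫ x, f x ∂weightedVolume g φ =
      ∫ x, f x * Real.exp (-φ x) ∂riemannianVolume g := by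
  rw [weightedVolume, integral_withDensity_eq_integral_toReal_smul
    (by fun_prop) (by simp)]
  congr 1
  funext x
  rw [ENNReal.toReal_ofReal (Real.exp_pos _).le, smul_eq_mul, mul_comm]

theorem sobolevNormSq_eq_lintegral (g : SmoothMetric n M) {φ : M → ℝ} (hφ : Continuous φ)
    {v : M → EuclideanSpace ℝ (Fin N)} (hv : ContMDiff (𝓡 n) (𝓡 N) ∞ v) :
    sobolevNormSq g φ v =
      ∫⁻ x, ENNReal.ofReal (‖v x‖ ^ 2 + gradNormSq g v x) ∂weightedVolume g φ := by
  have h1 : Continuous fun x => ‖v x‖ ^ 2 + gradNormSq g v x :=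
    (hv.continuous.norm.pow 2).add (continuous_gradNormSq g hv)
  rw [weightedVolume, lintegral_withDensity_eq_lintegral_mul _ (by fun_prop)
    h1.measurable.ennreal_ofReal, sobolevNormSq]
  congr 1
  funext x
  rw [Pi.mul_apply, ← ENNReal.ofReal_mul (Real.exp_pos _).le, mul_comm]

theorem lintegral_norm_sq_le_sobolevNormSq (g : SmoothMetric n M) {φ : M → ℝ} (hφ : Continuous φ)
    {v : M → EuclideanSpace ℝ (Fin N)} (hv : ContMDiff (𝓡 n) (𝓡 N) ∞ v) :
    ∫⁻ x, ENNReal.ofReal (‖v x‖ ^ 2) ∂weightedVolume g φ ≤ sobolevNormSq g φ v := by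
  rw [sobolevNormSq_eq_lintegral g hφ hv]
  refine lintegral_mono fun x => ENNReal.ofReal_le_ofReal ?_
  linarith [gradNormSq_nonneg g v x]

theorem lintegral_gradNormSq_le_sobolevNormSq (g : SmoothMetric n M) {φ : M → ℝ}
    (hφ : Continuous φ) {v : M → EuclideanSpace ℝ (Fin N)} (hv : ContMDiff (𝓡 n) (𝓡 N) ∞ v) :
    ∫⁻ x, ENNReal.ofReal (gradNormSq g v x) ∂weightedVolume g φ ≤ sobolevNormSq g φ v := by
  rw [sobolevNormSq_eq_lintegral g hφ hv]
  refine lintegral_mono fun x => ENNReal.ofReal_le_ofReal ?_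
  linarith [sq_nonneg ‖v x‖]

theorem integral_norm_sq_le (g : SmoothMetric n M) {φ : M → ℝ} (hφ : Continuous φ)
    {v : M → EuclideanSpace ℝ (Fin N)} (hv : ContMDiff (𝓡 n) (𝓡 N) ∞ v) {K : ℝ≥0}
    (hK : sobolevNormSq g φ v ≤ K) : ∫ x, ‖v x‖ ^ 2 ∂weightedVolume g φ ≤ K := by
  rw [integral_eq_lintegral_of_nonneg_ae (Eventually.of_forall fun x => sq_nonneg _)
    (hv.continuous.norm.pow 2).measurable.aestronglyMeasurable]
  refine ENNReal.toReal_le_of_le_ofReal K.coe_nonneg ?_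
  rw [ENNReal.ofReal_coe_nnreal]
  exact (lintegral_norm_sq_le_sobolevNormSq g hφ hv).trans hK

theorem memLp_of_sobolevNormSq_lt_top (g : SmoothMetric n M) {φ : M → ℝ} (hφ : Continuous φ)
    {v : M → EuclideanSpace ℝ (Fin N)} (hv : ContMDiff (𝓡 n) (𝓡 N) ∞ v)
    (hfin : sobolevNormSq g φ v < ⊤) : MemLp v 2 (weightedVolume g φ) := by
  rw [memLp_two_iff_integrable_sq_norm hv.continuous.aestronglyMeasurable]
  refine ⟨(hv.continuous.norm.pow 2).aestronglyMeasurable, ?_⟩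
  rw [hasFiniteIntegral_iff_ofReal (Eventually.of_forall fun x => sq_nonneg _)]
  exact (lintegral_norm_sq_le_sobolevNormSq g hφ hv).trans_lt hfin

variable [SecondCountableTopology M]

theorem isLocallyFiniteMeasure_weightedVolume (g : SmoothMetric n M) {φ : M → ℝ}
    (hφ : Continuous φ) : IsLocallyFiniteMeasure (weightedVolume g φ) := by
  have := riemannianVolume_isLocallyFinite g
  exact IsLocallyFiniteMeasure.withDensity_ofReal (by fun_prop)

/-- A continuous function that vanishes almost everywhere with respect to `e^{-φ} dvol`
vanishes. -/
theorem eq_zero_of_ae_eq_zero_weightedVolume (g : SmoothMetric n M) {φ : M → ℝ}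
    (hφ : Continuous φ) {v : M → EuclideanSpace ℝ (Fin N)} (hv : Continuous v)
    (h0 : v =ᵐ[weightedVolume g φ] 0) : v = 0 := by
  have := riemannianVolume_isOpenPos g
  have hac : riemannianVolume g ≪ weightedVolume g φ :=
    withDensity_absolutelyContinuous' (by fun_prop)
      (Eventually.of_forall fun x => by simp [Real.exp_pos])
  exact (Continuous.ae_eq_iff_eq (riemannianVolume g) hv continuous_zero).1 (hac.ae_eq h0)

variable [T2Space M]

/-- The weak form of `ℒ_φ v = f` against compactly supported maps. -/
theorem integral_inner_eq_neg_gradPair_of_hasCompactSupport (g : SmoothMetric n M) {φ : M → ℝ}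
    (hφ : ContMDiff (𝓡 n) 𝓘(ℝ, ℝ) ∞ φ) {f v ψ : M → EuclideanSpace ℝ (Fin N)}
    (hv : ContMDiff (𝓡 n) (𝓡 N) ∞ v) (hf : ∀ x, f x = driftLaplacian g φ v x)
    (hψ : ContMDiff (𝓡 n) (𝓡 N) ∞ ψ) (hc : HasCompactSupport ψ) :
    ∫ x, inner ℝ (f x) (ψ x) ∂weightedVolume g φ =
      -∫ x, gradPair g v ψ x ∂weightedVolume g φ := by
  have := isLocallyFiniteMeasure_weightedVolume g hφ.continuous
  have hck : ∀ k, HasCompactSupport fun x => ψ x k := fun k =>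
    hc.comp_left (g := fun y : EuclideanSpace ℝ (Fin N) => y k) rfl
  have hfk : ∀ k x, f x k = laplacian g (fun y => v y k) x - gradInner g (fun y => v y k) φ x := by
    intro k x
    rw [hf]
    rfl
  have hinner : ∀ x, inner ℝ (f x) (ψ x) =
      ∑ k, (laplacian g (fun y => v y k) x - gradInner g (fun y => v y k) φ x) * ψ x k := by
    intro x
    rw [PiLp.inner_apply]
    refine Finset.sum_congr rfl fun k _ => ?_
    rw [← hfk]
    simp [mul_comm]
  simp only [hinner, gradPair]
  rw [integral_finsetSum, integral_finsetSum, ← Finset.sum_neg_distrib]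
  · refine Finset.sum_congr rfl fun k _ => ?_
    rw [integral_weightedVolume g hφ.continuous, integral_weightedVolume g hφ.continuous]
    exact integral_driftLaplacian g hφ (contMDiff_component hv k) (contMDiff_component hψ k) (hck k)
  · exact fun k _ => (continuous_gradInner g (contMDiff_component hv k)
      (contMDiff_component hψ k)).integrable_of_hasCompactSupport
        (hasCompactSupport_gradInner g _ (hck k))
  · exact fun k _ => (((continuous_laplacian g (contMDiff_component hv k)).sub
      (continuous_gradInner g (contMDiff_component hv k) hφ)).mul
        (contMDiff_component hψ k).continuous).integrable_of_hasCompactSupport (hck k).mul_left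

/-- The weak form of `ℒ_φ v = f` against maps in the weighted Sobolev space. -/
theorem integral_inner_eq_neg_gradPair (g : SmoothMetric n M) {φ : M → ℝ}
    (hφ : ContMDiff (𝓡 n) 𝓘(ℝ, ℝ) ∞ φ) {f v w : M → EuclideanSpace ℝ (Fin N)}
    (hv : ContMDiff (𝓡 n) (𝓡 N) ∞ v) (hvS : sobolevNormSq g φ v < ⊤)
    (hfs : ContMDiff (𝓡 n) (𝓡 N) ∞ f) (hfS : sobolevNormSq g φ f < ⊤)
    (hf : ∀ x, f x = driftLaplacian g φ v x) (hw : SmoothMemW12 g φ w) :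
    ∫ x, inner ℝ (f x) (w x) ∂weightedVolume g φ =
      -∫ x, gradPair g v w x ∂weightedVolume g φ := by
  have := isLocallyFiniteMeasure_weightedVolume g hφ.continuous
  obtain ⟨hws, ψ, hψ, hlim⟩ := hw
  have hd : ∀ k, ContMDiff (𝓡 n) (𝓡 N) ∞ fun x => w x - ψ k x := fun k => hws.sub (hψ k).1
  -- This is the Cauchy–Schwarz bound for both passages to the limit, with `C` the squared Sobolev
  -- norm of `f` on the left side of the identity and of `v` on the right.
  have hlim' : ∀ C : ℝ≥0∞, C < ⊤ → Tendsto (fun k => C ^ (1 / 2 : ℝ) *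
      (sobolevNormSq g φ (fun x => w x - ψ k x)) ^ (1 / 2 : ℝ)) atTop (𝓝 0) := by
    intro C hC
    have h1 := hlim.ennrpow_const (1 / 2 : ℝ)
    rw [ENNReal.zero_rpow_of_pos (by norm_num)] at h1
    have h2 := ENNReal.Tendsto.const_mul (a := C ^ (1 / 2 : ℝ)) h1
      (Or.inr (ENNReal.rpow_ne_top_of_nonneg (by norm_num) hC.ne))
    rwa [mul_zero] at h2
  have hL : Tendsto (fun k => ∫ x, inner ℝ (f x) (ψ k x) ∂weightedVolume g φ) atTop
      (𝓝 (∫ x, inner ℝ (f x) (w x) ∂weightedVolume g φ)) := by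
    refine tendsto_integral_of_L1 _ (hfs.continuous.inner hws.continuous).aestronglyMeasurable
      (Eventually.of_forall fun k => ?_) ?_
    · exact (hfs.continuous.inner (hψ k).1.continuous).integrable_of_hasCompactSupport
        ((hψ k).2.mono fun x hx h => hx (by simp [h]))
    · refine tendsto_of_tendsto_of_tendsto_of_le_of_le tendsto_const_nhds (hlim' _ hfS)
        (fun _ => zero_le) fun k => ?_
      refine (lintegral_enorm_le_of_abs_le_sqrt (p := fun x => ‖f x‖ ^ 2)
        (q := fun x => ‖w x - ψ k x‖ ^ 2) (hfs.continuous.norm.pow 2).aemeasurable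
        ((hd k).continuous.norm.pow 2).aemeasurable fun x => ?_).trans ?_
      · rw [← inner_sub_right, Real.sqrt_sq (norm_nonneg _), Real.sqrt_sq (norm_nonneg _),
          norm_sub_rev]
        exact abs_real_inner_le_norm _ _
      · gcongr
        · exact lintegral_norm_sq_le_sobolevNormSq g hφ.continuous hfs
        · exact lintegral_norm_sq_le_sobolevNormSq g hφ.continuous (hd k)
  have hR : Tendsto (fun k => ∫ x, gradPair g v (ψ k) x ∂weightedVolume g φ) atTop
      (𝓝 (∫ x, gradPair g v w x ∂weightedVolume g φ)) := by
    refine tendsto_integral_of_L1 _ (continuous_gradPair g hv hws).aestronglyMeasurable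
      (Eventually.of_forall fun k => ?_) ?_
    · refine integrable_finsetSum _ fun j _ => ?_
      exact (continuous_gradInner g (contMDiff_component hv j)
        (contMDiff_component (hψ k).1 j)).integrable_of_hasCompactSupport
          (hasCompactSupport_gradInner g _ ((hψ k).2.comp_left
            (g := fun y : EuclideanSpace ℝ (Fin N) => y j) rfl))
    · refine tendsto_of_tendsto_of_tendsto_of_le_of_le tendsto_const_nhds (hlim' _ hvS)
        (fun _ => zero_le) fun k => ?_
      refine (lintegral_enorm_le_of_abs_le_sqrt (p := gradNormSq g v)
        (q := gradNormSq g fun x => w x - ψ k x) (continuous_gradNormSq g hv).aemeasurable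
        (continuous_gradNormSq g (hd k)).aemeasurable fun x => ?_).trans ?_
      · rw [abs_sub_comm, ← gradPair_sub_right g hws (hψ k).1]
        exact abs_gradPair_le g _ _ x
      · gcongr
        · exact lintegral_gradNormSq_le_sobolevNormSq g hφ.continuous hv
        · exact lintegral_gradNormSq_le_sobolevNormSq g hφ.continuous (hd k)
  refine tendsto_nhds_unique hL (hR.neg.congr fun k => ?_)
  exact (integral_inner_eq_neg_gradPair_of_hasCompactSupport g hφ hv hf (hψ k).1 (hψ k).2).symm

end WeightedSpace

end DriftHeat

end

/-! ### Passage from the heat flow on `M` to curves in `L²(e^{-φ} dvol)` -/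

theorem corollary1p2 {n N : ℕ} {M : Type*} [TopologicalSpace M] [T2Space M]
    [SecondCountableTopology M] [ChartedSpace (EuclideanSpace ℝ (Fin n)) M]
    [IsManifold (𝓡 n) ∞ M] [MeasurableSpace M] [BorelSpace M]
    (g : DriftHeat.SmoothMetric n M) (φ : M → ℝ) (hφ : ContMDiff (𝓡 n) 𝓘(ℝ, ℝ) ∞ φ)
    (a b : ℝ) (hab : a < b) (u : M → ℝ → EuclideanSpace ℝ (Fin N))
    -- `u` is smooth on `M × [a, b]`
    (hu : ContMDiffOn ((𝓡 n).prod 𝓘(ℝ, ℝ)) (𝓡 N) ∞ (fun q : M × ℝ => u q.1 q.2)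
      (Set.univ ×ˢ Set.Icc a b))
    -- `u` and `u_t` belong to `W^{1,2}_φ` at each time
    (hW : ∀ t ∈ Set.Icc a b, DriftHeat.SmoothMemW12 g φ (fun x => u x t) ∧
      DriftHeat.SmoothMemW12 g φ (DriftHeat.timeDeriv a b u t))
    -- with norms bounded uniformly in time
    (hK : ∃ K : ℝ≥0, ∀ t ∈ Set.Icc a b, DriftHeat.sobolevNormSq g φ (fun x => u x t) ≤ K ∧
      DriftHeat.sobolevNormSq g φ (DriftHeat.timeDeriv a b u t) ≤ K)
    -- the drift heat equation `(∂_t - L_φ) u = 0`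
    (hheat : ∀ x, ∀ t ∈ Set.Icc a b,
      DriftHeat.timeDeriv a b u t x - DriftHeat.driftLaplacian g φ (fun y => u y t) x = 0) :
    DriftHeat.energyI g φ (fun x => u x b) ≥
        DriftHeat.energyI g φ (fun x => u x a) *
          Real.exp (2 * DriftHeat.frequency g φ (fun x => u x a) * (b - a)) ∧
      ((∀ x, u x b = 0) → ∀ x, ∀ t ∈ Set.Icc a b, u x t = 0) := by
  have hφc : Continuous φ := hφ.continuous
  obtain ⟨K, hK⟩ := hK
  set μ := DriftHeat.weightedVolume g φ with hμ
  have := ChartedSpace.locallyCompactSpace (EuclideanSpace ℝ (Fin n)) M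
  have := DriftHeat.isLocallyFiniteMeasure_weightedVolume g hφc
  have hus : ∀ t ∈ Set.Icc a b, ContMDiff (𝓡 n) (𝓡 N) ∞ fun x => u x t := fun t ht => (hW t ht).1.1
  have hvs : ∀ t ∈ Set.Icc a b, ContMDiff (𝓡 n) (𝓡 N) ∞ (DriftHeat.timeDeriv a b u t) :=
    fun t ht => (hW t ht).2.1
  have huS : ∀ t ∈ Set.Icc a b, DriftHeat.sobolevNormSq g φ (fun x => u x t) < ⊤ :=
    fun t ht => (hK t ht).1.trans_lt ENNReal.coe_lt_top
  have hvS : ∀ t ∈ Set.Icc a b, DriftHeat.sobolevNormSq g φ (DriftHeat.timeDeriv a b u t) < ⊤ :=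
    fun t ht => (hK t ht).2.trans_lt ENNReal.coe_lt_top
  have huL : ∀ t ∈ Set.Icc a b, MemLp (fun x => u x t) 2 μ := fun t ht =>
    DriftHeat.memLp_of_sobolevNormSq_lt_top g hφc (hus t ht) (huS t ht)
  have hvL : ∀ t ∈ Set.Icc a b, MemLp (DriftHeat.timeDeriv a b u t) 2 μ := fun t ht =>
    DriftHeat.memLp_of_sobolevNormSq_lt_top g hφc (hvs t ht) (hvS t ht)
  have hv2 : ∀ t ∈ Set.Icc a b, ∫ x, ‖DriftHeat.timeDeriv a b u t x‖ ^ 2 ∂μ ≤ K := fun t ht =>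
    DriftHeat.integral_norm_sq_le g hφc (hvs t ht) (hK t ht).2
  have hweak : ∀ s ∈ Set.Icc a b, ∀ t ∈ Set.Icc a b,
      ∫ x, inner ℝ (DriftHeat.timeDeriv a b u s x) (u x t) ∂μ =
        -∫ x, DriftHeat.gradPair g (fun x => u x s) (fun x => u x t) x ∂μ := fun s hs t ht =>
    DriftHeat.integral_inner_eq_neg_gradPair g hφ (hus s hs) (huS s hs) (hvs s hs) (hvS s hs)
      (fun x => sub_eq_zero.1 (hheat x s hs)) (hW t ht).1
  have hcd : ∀ x, ContDiffOn ℝ 1 (u x) (Set.Icc a b) := by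
    intro x
    have h1 : ContMDiff 𝓘(ℝ, ℝ) ((𝓡 n).prod 𝓘(ℝ, ℝ)) ∞ fun τ : ℝ => (x, τ) :=
      contMDiff_const.prodMk contMDiff_id
    have h2 : ContMDiffOn 𝓘(ℝ, ℝ) (𝓡 N) ∞ (u x) (Set.Icc a b) :=
      hu.comp h1.contMDiffOn fun τ hτ => ⟨Set.mem_univ _, hτ⟩
    exact (contMDiffOn_iff_contDiffOn.1 h2).of_le (by norm_num)
  classical
  set U : ℝ → Lp (EuclideanSpace ℝ (Fin N)) 2 μ := fun t =>
    if ht : t ∈ Set.Icc a b then (huL t ht).toLp else 0 with hU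
  set V : ℝ → Lp (EuclideanSpace ℝ (Fin N)) 2 μ := fun t =>
    if ht : t ∈ Set.Icc a b then (hvL t ht).toLp else 0 with hV
  have hUae : ∀ t ∈ Set.Icc a b, U t =ᵐ[μ] fun x => u x t := fun t ht => by
    simp only [hU, dif_pos ht]
    exact MemLp.coeFn_toLp _
  have hVae : ∀ t ∈ Set.Icc a b, V t =ᵐ[μ] DriftHeat.timeDeriv a b u t := fun t ht => by
    simp only [hV, dif_pos ht]
    exact MemLp.coeFn_toLp _
  have hVU : ∀ s ∈ Set.Icc a b, ∀ t ∈ Set.Icc a b, inner ℝ (V s) (U t) =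
      -∫ x, DriftHeat.gradPair g (fun x => u x s) (fun x => u x t) x ∂μ := fun s hs t ht => by
    rw [← hweak s hs t ht, L2.inner_def]
    refine integral_congr_ae ?_
    filter_upwards [hVae s hs, hUae t ht] with x h1 h2
    rw [h1, h2]
  have hUn : ∀ t ∈ Set.Icc a b, ‖U t‖ ^ 2 = ∫ x, ‖u x t‖ ^ 2 ∂μ := fun t ht => by
    rw [← real_inner_self_eq_norm_sq, L2.inner_def]
    refine integral_congr_ae ?_
    filter_upwards [hUae t ht] with x h1
    rw [h1, real_inner_self_eq_norm_sq]
  have hVn : ∀ t ∈ Set.Icc a b, ‖V t‖ ≤ √K := fun t ht => by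
    refine Real.le_sqrt_of_sq_le (le_trans (le_of_eq ?_) (hv2 t ht))
    rw [← real_inner_self_eq_norm_sq, L2.inner_def]
    refine integral_congr_ae ?_
    filter_upwards [hVae t ht] with x h1
    rw [h1, real_inner_self_eq_norm_sq]
  -- Self-adjointness of `ℒ_φ`, read off from the symmetry of the Dirichlet form.
  have hsym : ∀ s ∈ Set.Icc a b, ∀ t ∈ Set.Icc a b, inner ℝ (U s) (V t) = inner ℝ (V s) (U t) :=
    fun s hs t ht => by
      rw [real_inner_comm, hVU s hs t ht, hVU t ht s hs]
      simp only [DriftHeat.gradPair_comm g (fun x => u x s)]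
  have hint : ∀ w : Lp (EuclideanSpace ℝ (Fin N)) 2 μ, ∀ s ∈ Set.Icc a b, ∀ t ∈ Set.Icc a b,
      inner ℝ w (U t - U s) = ∫ τ in s..t, inner ℝ w (V τ) := by
    intro w s hs t ht
    have h1 := DriftHeat.integral_inner_sub_eq (μ := μ) hu.continuousOn hab hcd hvL hv2
      (Lp.memLp w) hs ht
    rw [L2.inner_def]
    refine Eq.trans (integral_congr_ae ?_) (h1.trans (intervalIntegral.integral_congr ?_))
    · filter_upwards [Lp.coeFn_sub (U t) (U s), hUae t ht, hUae s hs] with x e1 e2 e3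
      rw [e1, Pi.sub_apply, e2, e3]
    · intro τ hτ
      simp only [L2.inner_def]
      refine integral_congr_ae ?_
      filter_upwards [hVae τ (Set.uIcc_subset_Icc hs ht hτ)] with x e1
      rw [e1]
      rfl
  have hI : ∀ t ∈ Set.Icc a b, DriftHeat.energyI g φ (fun x => u x t) = ‖U t‖ ^ 2 := fun t ht => by
    rw [hUn t ht, DriftHeat.energyI, hμ, DriftHeat.integral_weightedVolume g hφc]
  have ha : a ∈ Set.Icc a b := ⟨le_rfl, hab.le⟩
  have hb : b ∈ Set.Icc a b := ⟨hab.le, le_rfl⟩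
  have hD : DriftHeat.energyD g φ (fun x => u x a) = inner ℝ (U a) (V a) := by
    rw [hsym a ha a ha, hVU a ha a ha, DriftHeat.energyD, hμ,
      DriftHeat.integral_weightedVolume g hφc]
    rfl
  refine ⟨?_, fun h0 x t ht => ?_⟩
  · rw [DriftHeat.frequency, hI a ha, hI b hb, hD]
    exact DriftHeat.norm_sq_exp_le hab hVn hsym hint
  · have hUb : U b = 0 := by
      have h1 := hUn b hb
      simpa [h0] using h1
    have hUt := DriftHeat.eq_zero_of_weakDeriv_of_end_eq_zero hVn hsym hint hUb ht
    -- Vanishing in `L²` is only almost everywhere; continuity of `u(·,t)` makes it pointwise.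
    have h2 := DriftHeat.eq_zero_of_ae_eq_zero_weightedVolume g hφc (hus t ht).continuous (by
      have h3 := hUae t ht
      rw [hUt] at h3
      exact h3.symm.trans (Lp.coeFn_zero _ _ _))
    exact congrFun h2 x
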